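/- Let $k$ be a field. For a finite-dimensional Hopf algebra $H$ over $k$ with comultiplication $\Delta$, counit $\varepsilon$ and antipode $S$, and for $m \in \mathbb{Z}$, let the $m$-th Sweedler power map $P_H^{(m)} : H \to H$ be the $m$-th power of $\mathrm{id}_H$ with respect to the convolution product on $\mathrm{End}_k(H)$ (where $\mathrm{id}_H$ is invertible with inverse $S$). For $n \in \mathbb{Z}$ define the $n$-th indicator of $H$ by $$\nu_n(H) = \mathrm{Tr}\big(S \circ P_H^{(n-1)} : H \to H\big) \in k.$$ A twist of $H$ is an invertible element $F \in H \otimes H$ such that $(\varepsilon \otimes \mathrm{id})(F) = 1 = (\mathrm{id} \otimes \varepsilon)(F)$ and $(F \otimes 1)(\Delta \otimes \mathrm{id})(F) = (1 \otimes F)(\mathrm{id} \otimes \Delta)(F)$. For a twist $F$, let $H_F$ be the Hopf algebra that is $H$ as an algebra, with counit $\varepsilon$ and comultiplication $\Delta_F(h) = F \Delta(h) F^{-1}$. Hopf algebras $H$ and $H'$ over $k$ are gauge equivalent if $H' \cong H_F$ as Hopf algebras for some twist $F$ of $H$. **Theorem.** For every integer $n$, $\nu_n$ is a gauge invariant of finite-dimensional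 Hopf algebras: if $H$ and $H'$ are gauge equivalent finite-dimensional Hopf algebras over $k$, then $\nu_n(H) = \nu_n(H')$ for all $n \in \mathbb{Z}$. -/

import Mathlib

open scoped TensorProduct

noncomputable section

namespace HopfGauge

section Indicator

variable (k H : Type*) [Field k] [Ring H] [HopfAlgebra k H]

/-- The identity map of a Hopf algebra as a unit of the convolution algebra of its linear
endomorphisms; its convolution inverse is the antipode. -/
def idUnit : (WithConv (H →ₗ[k] H))ˣ where
  val := WithConv.toConv LinearMap.id
  inv := WithConv.toConv (HopfAlgebra.antipode k)
  val_inv := LinearMap.id_mul_antipode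
  inv_val := LinearMap.antipode_mul_id

/-- The `m`-th Sweedler power map, `m` any integer: the `m`-th power of the identity map
with respect to the convolution product. -/
def sweedlerPow (m : ℤ) : H →ₗ[k] H :=
  WithConv.ofConv ((idUnit k H ^ m : (WithConv (H →ₗ[k] H))ˣ) : WithConv (H →ₗ[k] H))

/-- The `n`-th indicator `Tr (S ∘ P^(n-1))` of a finite-dimensional Hopf algebra. -/
def indicator (n : ℤ) : k :=
  LinearMap.trace k H (HopfAlgebra.antipode k ∘ₗ sweedlerPow k H (n - 1))

end Indicator

section Gauge

variable {k H : Type*} [Field k] [Ring H] [HopfAlgebra k H]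

/-- An invertible `F ∈ H ⊗ H` is a gauge transformation if
`(ε ⊗ id) F = 1 = (id ⊗ ε) F`. -/
structure IsGaugeTransformation (F : (H ⊗[k] H)ˣ) : Prop where
  counit_left : Algebra.TensorProduct.lid k H
    (Algebra.TensorProduct.map (Bialgebra.counitAlgHom k H) (AlgHom.id k H)
      (F : H ⊗[k] H)) = 1
  counit_right : Algebra.TensorProduct.rid k k H
    (Algebra.TensorProduct.map (AlgHom.id k H) (Bialgebra.counitAlgHom k H)
      (F : H ⊗[k] H)) = 1

/-- A twist (dual 2-cocycle) is a gauge transformation `F` with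
`(F ⊗ 1) (Δ ⊗ id)(F) = (1 ⊗ F) (id ⊗ Δ)(F)`, an equation in `H ⊗ H ⊗ H`. -/
structure IsTwist (F : (H ⊗[k] H)ˣ) : Prop extends IsGaugeTransformation F where
  cocycle : Algebra.TensorProduct.assoc k k k H H H
      (((F : H ⊗[k] H) ⊗ₜ[k] (1 : H)) *
        Algebra.TensorProduct.map (Bialgebra.comulAlgHom k H) (AlgHom.id k H) (F : H ⊗[k] H)) =
    ((1 : H) ⊗ₜ[k] (F : H ⊗[k] H)) *
      Algebra.TensorProduct.map (AlgHom.id k H) (Bialgebra.comulAlgHom k H) (F : H ⊗[k] H)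

/-- The algebra map `Δ_F (h) = F Δ(h) F⁻¹`. -/
def twistedComul (F : (H ⊗[k] H)ˣ) : H →ₐ[k] H ⊗[k] H :=
  AlgHom.ofLinearMap
    (LinearMap.mulLeft k (F : H ⊗[k] H) ∘ₗ
      LinearMap.mulRight k ((F⁻¹ : (H ⊗[k] H)ˣ) : H ⊗[k] H) ∘ₗ Coalgebra.comul)
    (by simp)
    (fun x y => by simp [mul_assoc])

/-- The underlying algebra of `H_F = (H, Δ_F, ε)`: a copy of `H`. -/
@[nolint unusedArguments]
def Twisted {k H : Type*} [Field k] [Ring H] [HopfAlgebra k H] (_F : (H ⊗[k] H)ˣ) := H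

instance (F : (H ⊗[k] H)ˣ) : Ring (Twisted F) := inferInstanceAs (Ring H)

instance (F : (H ⊗[k] H)ˣ) : Algebra k (Twisted F) := inferInstanceAs (Algebra k H)

/-- The comultiplication `Δ_F` and the counit `ε` of `H_F`. -/
instance (F : (H ⊗[k] H)ˣ) : CoalgebraStruct k (Twisted F) where
  comul := ((twistedComul F).toLinearMap : H →ₗ[k] H ⊗[k] H)
  counit := (Coalgebra.counit : H →ₗ[k] k)

variable (k) in
/-- `H` and `H'` are gauge equivalent if `H' ≅ H_F` for some twist `F` of `H`. -/
def GaugeEquivalent (H H' : Type*) [Ring H] [HopfAlgebra k H] [Ring H'] [HopfAlgebra k H'] :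
    Prop :=
  ∃ F : (H ⊗[k] H)ˣ, IsTwist F ∧ Nonempty (H' ≃ₐc[k] Twisted F)

end Gauge

end HopfGauge

end

/-!
The proof expresses the indicators through integrals. A finite-dimensional Hopf algebra has a nonzero
left integral `Λ` (`exists_isLeftIntegral_ne_zero`) and then a functional `t` with `Λ₁ t(Λ₂) = 1`.
For such a pair `Λ₁ t(y Λ₂) = S(y)`, so that a trace against `S` can be evaluated:
`ν_n(H) = t(P⁽ⁿ⁾(Λ))` (`IsIntegralPair.indicator_eq`). Since `H_F` has the same product and counit
as `H`, the element `Λ` is also a left integral of `H_F`, and it remains to compare `P⁽ⁿ⁾(Λ)` and `t`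
with their counterparts for `H_F`.

Let `α` be the modular function, `Λ h = α(h) Λ`, and let `κ(h) = S(α(h₁) h₂)`. Factors can be moved
through `Δ(Λ)`:

* `Λ₁ ⊗ h Λ₂ = S(h) Λ₁ ⊗ Λ₂` and `Λ₁ h ⊗ Λ₂ = Λ₁ ⊗ Λ₂ κ(h)`,

whence `Δ_F(Λ) = F Δ(Λ) F⁻¹ = β Λ₁ ⊗ Λ₂ b'`, where `β` is the image of `F` under `a ⊗ b ↦ a S(b)`
and `b'` that of `F⁻¹` under `a ⊗ b ↦ κ(a) b`. Put `y = Λ₁ Λ₂ ⋯ Λₙ`. A factor travels in the same way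
through all the components of an iterated comultiplication of `Λ`, which by the cocycle equation
gives `y_F = β y b'` for the counterpart `y_F` of `y`, and `S(a) y = y κ(a)`; this is the content of
`PowerStage` and of `IsIntegralPair.itMul_twisted`, `IsIntegralPair.antipode_mul_itMul`.

The functional `t'` for `H_F` satisfies `t'(· b') = t(w ·)` with `S(w) = β⁻¹`, where `β⁻¹` is the
image of `F⁻¹` under `a ⊗ b ↦ S(a) b` (`IsIntegralPair.exists_comp_mulRight_eq`). Hence
`t'(y_F) = t(w β y)`. As `κ ∘ S` is the Nakayama automorphism of `t`, the relation `S(a) y = y κ(a)`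
says that `t(a c y) = t(c S²(a) y)`. With `F⁻¹ = Σ u ⊗ v` this yields
`t(w β y) = Σ t(S⁻¹(v) u β y) = Σ t(u β S(v) y) = t(y)`, because `Σ u β S(v)` is the image of
`F⁻¹ F = 1` under `a ⊗ b ↦ a S(b)` (`IsIntegralPair.apply_mul_mulAntipode_mul`). For negative `n` the
same argument applies to `S(Λₘ ⋯ Λ₂ Λ₁)`, and for `n = 0` to `y = 1`, where either `ε(Λ) = 0` or
`α = ε`.
-/

open scoped TensorProduct

namespace HopfGauge

open Coalgebra HopfAlgebra WithConv TensorProduct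

/-! ### Convolution identities in `Hom(H, H ⊗ H)` -/

section Convolution

variable {k H : Type*} [Field k] [Ring H] [HopfAlgebra k H]

/-- `x ↦ x ⊗ 1` in the convolution algebra `Hom(H, H ⊗ H)`. -/
noncomputable def inl : WithConv (H →ₗ[k] H ⊗[k] H) :=
  toConv (Algebra.TensorProduct.includeLeft (R := k) (S := k) (A := H) (B := H)).toLinearMap

/-- `x ↦ 1 ⊗ x` in the convolution algebra `Hom(H, H ⊗ H)`. -/
noncomputable def inr : WithConv (H →ₗ[k] H ⊗[k] H) :=
  toConv (Algebra.TensorProduct.includeRight (R := k) (A := H) (B := H)).toLinearMap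

/-- `x ↦ S x ⊗ 1`, the convolution inverse of `inl`. -/
noncomputable def inlS : WithConv (H →ₗ[k] H ⊗[k] H) := toConv (inl.ofConv ∘ₗ antipode k)

/-- `x ↦ 1 ⊗ S x`, the convolution inverse of `inr`. -/
noncomputable def inrS : WithConv (H →ₗ[k] H ⊗[k] H) := toConv (inr.ofConv ∘ₗ antipode k)

@[simp] lemma inl_apply (x : H) : (inl (k := k)) x = x ⊗ₜ[k] (1 : H) := rfl
@[simp] lemma inr_apply (x : H) : (inr (k := k)) x = (1 : H) ⊗ₜ[k] x := rfl
@[simp] lemma inlS_apply (x : H) : (inlS (k := k)) x = antipode k x ⊗ₜ[k] (1 : H) := rfl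
@[simp] lemma inrS_apply (x : H) : (inrS (k := k)) x = (1 : H) ⊗ₜ[k] antipode k x := rfl

lemma inl_mul_inr : (inl * inr : WithConv (H →ₗ[k] H ⊗[k] H)) = toConv comul := by
  ext x
  rw [(ℛ k x).convMul_apply]
  simpa using (ℛ k x).eq

lemma inlS_mul_inl : (inlS * inl : WithConv (H →ₗ[k] H ⊗[k] H)) = 1 := by
  ext x
  rw [(ℛ k x).convMul_apply]
  simp [← sum_tmul, sum_antipode_mul_eq_algebraMap_counit (ℛ k x)]

lemma inrS_mul_inr : (inrS * inr : WithConv (H →ₗ[k] H ⊗[k] H)) = 1 := by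
  ext x
  rw [(ℛ k x).convMul_apply]
  simp [← tmul_sum, sum_antipode_mul_eq_algebraMap_counit (ℛ k x),
    Algebra.algebraMap_eq_smul_one, Algebra.TensorProduct.one_def]

lemma inr_mul_inrS : (inr * inrS : WithConv (H →ₗ[k] H ⊗[k] H)) = 1 := by
  ext x
  rw [(ℛ k x).convMul_apply]
  simp [← tmul_sum, sum_mul_antipode_eq_algebraMap_counit (ℛ k x),
    Algebra.algebraMap_eq_smul_one, Algebra.TensorProduct.one_def]

/-- `x₁ ⊗ S(x₂) x₃ = x ⊗ 1`. -/
lemma inl_mul_inrS_mul_inr : (inl * inrS * inr : WithConv (H →ₗ[k] H ⊗[k] H)) = inl := by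
  rw [mul_assoc, inrS_mul_inr, mul_one]

lemma sum_counit_right_smul {ι : Type*} {x : H} (r : Repr k x ι) :
    ∑ i ∈ r.index, counit (R := k) (r.right i) • r.left i = x := by
  have h := congr(TensorProduct.rid k H $(sum_tmul_counit_eq (R := k) r))
  simpa only [map_sum, TensorProduct.rid_tmul, one_smul] using h

/-- `S(x₁) ⊗ 1` times `Δ(x₂)` is `1 ⊗ x`. -/
lemma sum_antipode_tmul_one_mul_comul {ι : Type*} {x : H} (r : Repr k x ι) :
    ∑ i ∈ r.index, (antipode k (r.left i) ⊗ₜ[k] (1 : H)) * comul (R := k) (r.right i) =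
      1 ⊗ₜ[k] x := by
  have h : (inlS * toConv comul : WithConv (H →ₗ[k] H ⊗[k] H)) = inr := by
    rw [← inl_mul_inr, ← mul_assoc, inlS_mul_inl, one_mul]
  simpa [r.convMul_apply] using congr($h x)

/-- `Δ(x₁)` times `1 ⊗ S(x₂)` is `x ⊗ 1`. -/
lemma sum_comul_mul_one_tmul_antipode {ι : Type*} {x : H} (r : Repr k x ι) :
    ∑ i ∈ r.index, comul (R := k) (r.left i) * ((1 : H) ⊗ₜ[k] antipode k (r.right i)) =
      x ⊗ₜ[k] 1 := by
  have h : (toConv comul * inrS : WithConv (H →ₗ[k] H ⊗[k] H)) = inl := by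
    rw [← inl_mul_inr, mul_assoc, inr_mul_inrS, mul_one]
  simpa [r.convMul_apply] using congr($h x)

/-- The contraction `a ⊗ b ↦ φ(b) a`. -/
noncomputable def slice (φ : H →ₗ[k] k) : H ⊗[k] H →ₗ[k] H :=
  (TensorProduct.rid k H).toLinearMap ∘ₗ φ.lTensor H

@[simp] lemma slice_tmul (φ : H →ₗ[k] k) (a b : H) : slice φ (a ⊗ₜ[k] b) = φ b • a := by
  simp [slice]

lemma slice_mul_tmul (φ : H →ₗ[k] k) (a b : H) (X : H ⊗[k] H) :
    slice φ ((a ⊗ₜ[k] b) * X) = a * slice (φ ∘ₗ LinearMap.mulLeft k b) X := by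
  induction X with
  | zero => simp
  | tmul u v => simp
  | add X Y hX hY => simp only [mul_add, map_add, hX, hY]

lemma slice_tmul_mul (φ : H →ₗ[k] k) (a b : H) (X : H ⊗[k] H) :
    slice φ (X * (a ⊗ₜ[k] b)) = slice (φ ∘ₗ LinearMap.mulRight k b) X * a := by
  induction X with
  | zero => simp
  | tmul u v => simp
  | add X Y hX hY => simp only [add_mul, map_add, hX, hY]

@[simp] lemma slice_add (φ ψ : H →ₗ[k] k) (X : H ⊗[k] H) :
    slice (φ + ψ) X = slice φ X + slice ψ X := by
  simp [slice, LinearMap.lTensor_add]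

@[simp] lemma slice_smul (c : k) (φ : H →ₗ[k] k) (X : H ⊗[k] H) :
    slice (c • φ) X = c • slice φ X := by
  simp [slice, LinearMap.lTensor_smul]

@[simp] lemma slice_zero (X : H ⊗[k] H) : slice (0 : H →ₗ[k] k) X = 0 := by
  simp [slice]

end Convolution

/-! ### Existence of integrals -/

section Integral

variable {k H : Type*} [Field k] [Ring H] [HopfAlgebra k H]

variable (k) in
/-- A left integral of `H`: an element `Λ` with `h Λ = ε(h) Λ` for all `h`. -/
def IsLeftIntegral (Λ : H) : Prop := ∀ h : H, h * Λ = counit (R := k) h • Λ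

/-- `S(y) Λ₁ ⊗ Λ₂ = Λ₁ ⊗ y Λ₂` for a left integral `Λ`. -/
lemma IsLeftIntegral.antipode_tmul_one_mul_comul {Λ : H} (hΛ : IsLeftIntegral k Λ) (y : H) :
    (antipode k y ⊗ₜ[k] (1 : H)) * comul (R := k) Λ = ((1 : H) ⊗ₜ[k] y) * comul (R := k) Λ := by
  rw [← sum_antipode_tmul_one_mul_comul (ℛ k y), Finset.sum_mul]
  simp only [mul_assoc, ← Bialgebra.comul_mul, hΛ _, map_smul]
  conv_lhs => rw [← sum_counit_right_smul (ℛ k y)]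
  simp only [map_sum, map_smul, sum_tmul, Finset.sum_mul, ← smul_tmul', smul_mul_assoc,
    mul_smul_comm]

lemma IsLeftIntegral.slice_comul_mulLeft {Λ : H} (hΛ : IsLeftIntegral k Λ) (φ : H →ₗ[k] k)
    (y : H) : slice (φ ∘ₗ LinearMap.mulLeft k y) (comul (R := k) Λ) =
      antipode k y * slice φ (comul (R := k) Λ) := by
  have h := congr(slice φ $(hΛ.antipode_tmul_one_mul_comul y))
  rw [slice_mul_tmul, slice_mul_tmul] at h
  simpa [LinearMap.mulLeft_one] using h.symm

lemma inl_mul_inrS_apply (x : H) :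
    (inl * inrS : WithConv (H →ₗ[k] H ⊗[k] H)) x =
      (antipode k).lTensor H (comul (R := k) x) := by
  rw [(ℛ k x).convMul_apply, ← (ℛ k x).eq]
  simp

/-- With `K(y) = φ(y₁) S(y₂)`, one has `K(h₁ x) h₂ = φ(h x₁) S(x₂)`; here `X` stands for
`x₁ ⊗ x₂`. -/
lemma sum_slice_comul_mul (φ : H →ₗ[k] k) {ι : Type*} {h : H} (r : Repr k h ι) (X : H ⊗[k] H) :
    ∑ i ∈ r.index, LinearMap.mul' k H (TensorProduct.map (Algebra.linearMap k H ∘ₗ φ)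
        (antipode k) (comul (R := k) (r.left i) * X)) * r.right i =
      LinearMap.mul' k H (TensorProduct.map (Algebra.linearMap k H ∘ₗ φ)
        (antipode k) ((h ⊗ₜ[k] (1 : H)) * X)) := by
  induction X with
  | zero => simp
  | add X Y hX hY => simp only [mul_add, map_add, add_mul, Finset.sum_add_distrib, hX, hY]
  | tmul u v =>
    let m : H ⊗[k] H →ₗ[k] H := LinearMap.mul' k H ∘ₗ TensorProduct.map
      (Algebra.linearMap k H ∘ₗ φ ∘ₗ LinearMap.mulRight k u)
      (LinearMap.mulLeft k (antipode k v))
    have hm (Y : H ⊗[k] H) : LinearMap.mul' k H (TensorProduct.map (Algebra.linearMap k H ∘ₗ φ)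
        (antipode k) (Y * (u ⊗ₜ[k] v))) = m ((antipode k).lTensor H Y) := by
      induction Y with
      | zero => simp
      | add X Y hX hY => simp only [add_mul, map_add, hX, hY]
      | tmul p q => simp [m, antipode_mul_antidistrib]
    have hm' (Y : H ⊗[k] H) (c : H) : m Y * c = m (Y * ((1 : H) ⊗ₜ[k] c)) := by
      induction Y with
      | zero => simp
      | add X Y hX hY => simp only [add_mul, map_add, hX, hY]
      | tmul p q => simp [m, mul_assoc]
    have key := congr(m ($(inl_mul_inrS_mul_inr (k := k) (H := H)) h))
    rw [r.convMul_apply, map_sum] at key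
    simp only [hm, ← inl_mul_inrS_apply, hm']
    refine key.trans ?_
    simp [m]

variable [FiniteDimensional k H]

/-- The functional `φ ↦ Tr (x ↦ S (c φ(x₁) S(x₂)))` on the dual of `H`. -/
noncomputable def traceFunctional (c : H) : Module.Dual k (Module.Dual k H) where
  toFun φ := LinearMap.trace k H (antipode k ∘ₗ LinearMap.mulLeft k c ∘ₗ
    (toConv (Algebra.linearMap k H ∘ₗ φ) * toConv (antipode k)).ofConv)
  map_add' φ ψ := by
    simp [LinearMap.comp_add, add_mul]
  map_smul' a φ := by
    simp [LinearMap.comp_smul]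

lemma traceFunctional_comp_mulLeft (c h : H) (φ : H →ₗ[k] k) :
    traceFunctional c (φ ∘ₗ LinearMap.mulLeft k h) = counit (R := k) h • traceFunctional c φ := by
  set K : H →ₗ[k] H := antipode k ∘ₗ LinearMap.mulLeft k c ∘ₗ
    (toConv (Algebra.linearMap k H ∘ₗ φ) * toConv (antipode k)).ofConv with hK
  have key : antipode k ∘ₗ LinearMap.mulLeft k c ∘ₗ
      (toConv (Algebra.linearMap k H ∘ₗ φ ∘ₗ LinearMap.mulLeft k h) * toConv (antipode k)).ofConv =
      ∑ i ∈ (ℛ k h).index, LinearMap.mulLeft k (antipode k ((ℛ k h).right i)) ∘ₗ K ∘ₗ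
        LinearMap.mulLeft k ((ℛ k h).left i) := by
    ext x
    have h1 := sum_slice_comul_mul φ (ℛ k h) (comul (R := k) x)
    have h2 : LinearMap.mul' k H (TensorProduct.map (Algebra.linearMap k H ∘ₗ φ)
        (antipode k) ((h ⊗ₜ[k] (1 : H)) * comul (R := k) x)) =
        LinearMap.mul' k H (TensorProduct.map
          (Algebra.linearMap k H ∘ₗ φ ∘ₗ LinearMap.mulLeft k h) (antipode k) (comul x)) := by
      induction comul (R := k) x with
      | zero => simp
      | add X Y hX hY => simp only [mul_add, map_add, hX, hY]
      | tmul p q => simp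
    have h3 := congr(antipode k (c * $(h1.trans h2)))
    rw [Finset.mul_sum, map_sum] at h3
    simp only [← mul_assoc] at h3
    simpa [hK, antipode_mul_antidistrib, mul_assoc] using h3.symm
  have htr (i) : LinearMap.trace k H (LinearMap.mulLeft k (antipode k ((ℛ k h).right i)) ∘ₗ K ∘ₗ
      LinearMap.mulLeft k ((ℛ k h).left i)) = LinearMap.trace k H (K ∘ₗ
      LinearMap.mulLeft k ((ℛ k h).left i * antipode k ((ℛ k h).right i))) := by
    rw [LinearMap.trace_comp_comm', LinearMap.comp_assoc, LinearMap.mulLeft_mul]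
  change LinearMap.trace k H (antipode k ∘ₗ LinearMap.mulLeft k c ∘ₗ
      (toConv (Algebra.linearMap k H ∘ₗ φ ∘ₗ LinearMap.mulLeft k h) *
        toConv (antipode k)).ofConv) = counit h • LinearMap.trace k H K
  have hsum : ∑ i ∈ (ℛ k h).index, K ∘ₗ
      LinearMap.mulLeft k ((ℛ k h).left i * antipode k ((ℛ k h).right i)) =
      counit (R := k) h • K := by
    ext x
    simp only [LinearMap.sum_apply, LinearMap.comp_apply, LinearMap.mulLeft_apply,
      ← map_sum, ← Finset.sum_mul, sum_mul_antipode_eq_smul]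
    simp
  rw [key, map_sum, Finset.sum_congr rfl fun i _ => htr i, ← map_sum, hsum, map_smul]

variable (k H) in
/-- A finite-dimensional Hopf algebra has a nonzero left integral. If all the vectors of `H`
representing the functionals `traceFunctional c` vanished, then `Tr (S ∘ T)` would vanish for every
endomorphism `T`, forcing `S = 0`. -/
theorem exists_isLeftIntegral_ne_zero : ∃ Λ : H, IsLeftIntegral k Λ ∧ Λ ≠ 0 := by
  have : Nontrivial H := Bialgebra.nontrivial (R := k)
  by_contra! hcon
  have hzero (c : H) (φ : H →ₗ[k] k) : traceFunctional c φ = 0 := by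
    obtain ⟨t, ht⟩ := (Module.evalEquiv k H).surjective (traceFunctional c)
    have ht' (ψ : H →ₗ[k] k) : ψ t = traceFunctional c ψ := by rw [← ht]; rfl
    have hint : IsLeftIntegral k t := fun h => by
      refine (Module.forall_dual_apply_eq_zero_iff k _).1 (fun ψ => ?_) |> sub_eq_zero.1
      have := traceFunctional_comp_mulLeft c h ψ
      rw [← ht', ← ht'] at this
      rw [map_sub, map_smul, ← this]
      simp
    rw [← ht', hcon t hint, map_zero]
  have htrace (T : H →ₗ[k] H) : LinearMap.trace k H (antipode k ∘ₗ T) = 0 := by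
    have hg (g : H →ₗ[k] H) : LinearMap.trace k H
        (antipode k ∘ₗ (toConv g * toConv (antipode k)).ofConv) = 0 := by
      obtain ⟨z, rfl⟩ := (dualTensorHomEquiv k H H).surjective g
      induction z with
      | zero => simp
      | add x y hx hy => rw [map_add, toConv_add, add_mul, ofConv_add, LinearMap.comp_add,
          map_add, hx, hy, add_zero]
      | tmul φ c =>
        have : (toConv (dualTensorHomEquiv k H H (φ ⊗ₜ c)) * toConv (antipode k)).ofConv =
            LinearMap.mulLeft k c ∘ₗ
              (toConv (Algebra.linearMap k H ∘ₗ φ) * toConv (antipode k)).ofConv := by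
          ext x
          change (toConv (dualTensorHomEquiv k H H (φ ⊗ₜ c)) * toConv (antipode k) :
              WithConv (H →ₗ[k] H)) x =
            c * (toConv (Algebra.linearMap k H ∘ₗ φ) * toConv (antipode k) :
              WithConv (H →ₗ[k] H)) x
          rw [(ℛ k x).convMul_apply, (ℛ k x).convMul_apply, Finset.mul_sum]
          simp [Algebra.algebraMap_eq_smul_one]
        rw [this]
        exact hzero c φ
    have := hg (toConv T * toConv LinearMap.id).ofConv
    rwa [toConv_ofConv, mul_assoc, LinearMap.id_mul_antipode, mul_one] at this
  obtain ⟨ψ, hψ⟩ : ∃ ψ : Module.Dual k H, ψ 1 ≠ 0 := by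
    by_contra! h
    exact one_ne_zero ((Module.forall_dual_apply_eq_zero_iff k (1 : H)).1 h)
  have := htrace (ψ.smulRight 1)
  rw [show antipode k ∘ₗ ψ.smulRight 1 = ψ.smulRight (1 : H) by ext x; simp,
    LinearMap.trace_smulRight] at this
  exact hψ this

end Integral

/-! ### The Frobenius form of an integral -/

section Frobenius

variable {k H : Type*} [Field k] [Ring H] [HopfAlgebra k H]

/-- A left integral `Λ` together with a functional `t` such that `Λ₁ t(Λ₂) = 1`. -/
structure IsIntegralPair (Λ : H) (t : H →ₗ[k] k) : Prop where
  isLeftIntegral : IsLeftIntegral k Λ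
  slice_comul : slice t (comul (R := k) Λ) = 1

namespace IsIntegralPair

variable {Λ : H} {t : H →ₗ[k] k}

lemma ne_zero (p : IsIntegralPair Λ t) : Λ ≠ 0 := by
  have : Nontrivial H := Bialgebra.nontrivial (R := k)
  rintro rfl
  have := p.slice_comul
  simp at this

lemma slice_comul_mulLeft (p : IsIntegralPair Λ t) (y : H) :
    slice (t ∘ₗ LinearMap.mulLeft k y) (comul (R := k) Λ) = antipode k y := by
  rw [p.isLeftIntegral.slice_comul_mulLeft, p.slice_comul, mul_one]

lemma apply_self (p : IsIntegralPair Λ t) : t Λ = 1 := by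
  have h (X : H ⊗[k] H) : counit (R := k) (slice t X) =
      t (TensorProduct.lid k H (counit.rTensor H X)) := by
    induction X with
    | zero => simp
    | add X Y hX hY => simp only [map_add, hX, hY]
    | tmul u v => simp [mul_comm]
  simpa [p.slice_comul] using (h (comul Λ)).symm

end IsIntegralPair

variable [FiniteDimensional k H]

/-- The comultiplication of a nonzero left integral is a nondegenerate tensor. If `Λ₁ φ(Λ₂) = 0`
then `Λ₁ ⊗ φ(· Λ₂) = 0`, and applying `a ⊗ ψ ↦ a₁ ψ(y S(a₂))` to this tensor gives
`φ(y) Λ = 0`. -/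
lemma IsLeftIntegral.eq_zero_of_slice_comul {Λ : H} (hΛ : IsLeftIntegral k Λ) (h0 : Λ ≠ 0)
    {φ : H →ₗ[k] k} (hφ : slice φ (comul (R := k) Λ) = 0) : φ = 0 := by
  have hz : ∑ i ∈ (ℛ k Λ).index, (φ ∘ₗ LinearMap.mulRight k ((ℛ k Λ).right i) : Module.Dual k H)
      ⊗ₜ[k] (ℛ k Λ).left i = 0 := by
    apply (dualTensorHomEquiv k H H).injective
    ext y
    have h := hΛ.slice_comul_mulLeft φ y
    rw [hφ, mul_zero, ← (ℛ k Λ).eq] at h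
    simpa using h
  ext y
  let N : Module.Dual k H ⊗[k] H →ₗ[k] H := TensorProduct.lift <| LinearMap.mk₂ k
    (fun ψ l => slice (ψ ∘ₗ LinearMap.mulLeft k y) ((antipode k).lTensor H (comul (R := k) l)))
    (fun _ _ _ => by rw [LinearMap.add_comp, slice_add])
    (fun _ _ _ => by rw [LinearMap.smul_comp, slice_smul])
    (fun _ _ _ => by simp only [map_add])
    (fun _ _ _ => by simp only [map_smul])
  have hN := congr(N $hz)
  have key := congr(slice (φ ∘ₗ LinearMap.mulLeft k y)
    ($(inl_mul_inrS_mul_inr (k := k) (H := H)) Λ))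
  rw [(ℛ k Λ).convMul_apply] at key
  simp only [inl_mul_inrS_apply, inr_apply, inl_apply, map_sum, slice_tmul_mul, mul_one,
    slice_tmul] at key
  simp only [N, map_sum, TensorProduct.lift.tmul, LinearMap.mk₂_apply, map_zero] at hN
  have hcomp (c : H) : (φ ∘ₗ LinearMap.mulLeft k y) ∘ₗ LinearMap.mulRight k c =
      (φ ∘ₗ LinearMap.mulRight k c) ∘ₗ LinearMap.mulLeft k y := by
    ext; simp [mul_assoc]
  simp only [hcomp] at key
  rw [hN] at key
  simpa [h0] using key.symm

lemma IsLeftIntegral.ext_slice_comul {Λ : H} (hΛ : IsLeftIntegral k Λ) (h0 : Λ ≠ 0)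
    {φ ψ : H →ₗ[k] k} (h : slice φ (comul (R := k) Λ) = slice ψ (comul (R := k) Λ)) : φ = ψ := by
  rw [← sub_eq_zero]
  apply hΛ.eq_zero_of_slice_comul h0
  rw [sub_eq_add_neg, ← neg_one_smul k, slice_add, slice_smul, h]
  simp

variable (k H) in
lemma antipode_bijective : Function.Bijective (antipode k : H →ₗ[k] H) := by
  have hinj : Function.Injective (antipode k : H →ₗ[k] H) := by
    obtain ⟨Λ, hΛ, h0⟩ := exists_isLeftIntegral_ne_zero k H
    rw [injective_iff_map_eq_zero]
    intro y hy
    refine (Module.forall_dual_apply_eq_zero_iff k y).1 fun φ => ?_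
    have h := hΛ.eq_zero_of_slice_comul h0 (φ := φ ∘ₗ LinearMap.mulLeft k y)
      (by rw [hΛ.slice_comul_mulLeft, hy, zero_mul])
    simpa using congr($h 1)
  exact ⟨hinj, LinearMap.surjective_of_injective hinj⟩

/-- Every nonzero left integral `Λ` has a functional `t` with `Λ₁ t(Λ₂) = 1`. -/
lemma IsLeftIntegral.exists_slice_comul_eq_one {Λ : H} (hΛ : IsLeftIntegral k Λ) (h0 : Λ ≠ 0) :
    ∃ t : H →ₗ[k] k, slice t (comul (R := k) Λ) = 1 := by
  let Θ : Module.Dual k H →ₗ[k] H :=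
    { toFun := fun φ => slice φ (comul (R := k) Λ)
      map_add' := fun _ _ => slice_add _ _ _
      map_smul' := fun _ _ => slice_smul _ _ _ }
  have hinj : Function.Injective Θ := fun _ _ h => hΛ.ext_slice_comul h0 h
  exact (LinearMap.injective_iff_surjective_of_finrank_eq_finrank
    Subspace.dual_finrank_eq).1 hinj 1

namespace IsIntegralPair

variable {Λ : H} {t : H →ₗ[k] k}

/-- The bilinear form `t(x y)` is nondegenerate, so that every functional is of the form
`t(w ·)`. -/
lemma exists_eq_comp_mulLeft (p : IsIntegralPair Λ t) (φ : H →ₗ[k] k) :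
    ∃ w : H, φ = t ∘ₗ LinearMap.mulLeft k w := by
  let Θ : H →ₗ[k] Module.Dual k H := LinearMap.compr₂ (LinearMap.mul k H) t
  have hΘ (w : H) : Θ w = t ∘ₗ LinearMap.mulLeft k w := by ext; simp [Θ]
  have hinj : Function.Injective Θ := by
    rw [injective_iff_map_eq_zero]
    intro w hw
    apply (antipode_bijective k H).1
    rw [← p.slice_comul_mulLeft, ← hΘ, hw, slice_zero, map_zero]
  obtain ⟨w, hw⟩ := (LinearMap.injective_iff_surjective_of_finrank_eq_finrank
    Subspace.dual_finrank_eq.symm).1 hinj φ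
  exact ⟨w, by rw [← hΘ, hw]⟩

lemma eq_smul_of_isLeftIntegral (p : IsIntegralPair Λ t) {Λ' : H} (hΛ' : IsLeftIntegral k Λ') :
    Λ' = t Λ' • Λ := by
  rw [← sub_eq_zero]
  refine (Module.forall_dual_apply_eq_zero_iff k _).1 fun φ => ?_
  obtain ⟨w, rfl⟩ := p.exists_eq_comp_mulLeft φ
  simp [mul_sub, hΛ' w, p.isLeftIntegral w, p.apply_self, mul_comm]

lemma mul_eq_smul (p : IsIntegralPair Λ t) (h : H) : Λ * h = t (Λ * h) • Λ :=
  p.eq_smul_of_isLeftIntegral fun x => by rw [← mul_assoc, p.isLeftIntegral x, smul_mul_assoc]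

/-- The modular function `α` of `H`, defined by `Λ h = α(h) Λ` for a left integral `Λ`. -/
noncomputable def modular (p : IsIntegralPair Λ t) : H →ₐ[k] k :=
  AlgHom.ofLinearMap (t ∘ₗ LinearMap.mulLeft k Λ) (by simpa using p.apply_self) fun x y => by
    simp only [LinearMap.comp_apply, LinearMap.mulLeft_apply]
    rw [← mul_assoc, p.mul_eq_smul x, smul_mul_assoc, map_smul, map_smul, p.apply_self]
    simp

/-- The algebra automorphism `h ↦ α(h₁) h₂` of `H` given by the modular function. -/
noncomputable def modularTwist (p : IsIntegralPair Λ t) : H →ₐ[k] H :=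
  (Algebra.TensorProduct.lid k H).toAlgHom.comp
    ((Algebra.TensorProduct.map p.modular (AlgHom.id k H)).comp (Bialgebra.comulAlgHom k H))

/-- The map `κ(h) = S(α(h₁) h₂)`. It moves a factor of `Λ₁` across to `Λ₂`. -/
noncomputable def kappa (p : IsIntegralPair Λ t) : H →ₗ[k] H :=
  antipode k ∘ₗ p.modularTwist.toLinearMap

variable (p : IsIntegralPair Λ t)

lemma self_mul (h : H) : Λ * h = p.modular h • Λ := p.mul_eq_smul h

lemma modularTwist_eq_sum {ι : Type*} {h : H} (r : Repr k h ι) :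
    p.modularTwist h = ∑ i ∈ r.index, p.modular (r.left i) • r.right i := by
  simp [modularTwist, ← r.eq]

lemma kappa_eq_sum {ι : Type*} {h : H} (r : Repr k h ι) :
    p.kappa h = ∑ i ∈ r.index, p.modular (r.left i) • antipode k (r.right i) := by
  simp [kappa, p.modularTwist_eq_sum r]

lemma kappa_apply (h : H) : p.kappa h = antipode k (p.modularTwist h) := rfl

lemma modularTwist_surjective : Function.Surjective p.modularTwist := by
  intro h
  let a : WithConv (H →ₗ[k] H) := toConv (Algebra.linearMap k H ∘ₗ p.modular.toLinearMap)
  let a' : WithConv (H →ₗ[k] H) :=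
    toConv (Algebra.linearMap k H ∘ₗ p.modular.toLinearMap ∘ₗ antipode k)
  have ha : a' * a = 1 := by
    ext x
    rw [(ℛ k x).convMul_apply]
    have h1 (y : H) : a y = algebraMap k H (p.modular y) := rfl
    have h2 (y : H) : a' y = algebraMap k H (p.modular (antipode k y)) := rfl
    simp only [h1, h2, ← map_mul, ← map_sum, sum_antipode_mul_eq_smul]
    simp
  have htw (x : H) : p.modularTwist x = (a * toConv LinearMap.id : WithConv (H →ₗ[k] H)) x := by
    rw [(ℛ k x).convMul_apply, p.modularTwist_eq_sum (ℛ k x)]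
    simp [a, Algebra.smul_def]
  refine ⟨(a' * toConv LinearMap.id : WithConv (H →ₗ[k] H)) h, ?_⟩
  have key := congr($(show a' * (a * toConv LinearMap.id) = toConv LinearMap.id by
    rw [← mul_assoc, ha, one_mul]) h)
  rw [(ℛ k h).convMul_apply] at key ⊢
  simp only [← htw] at key
  simpa [a', ← Algebra.smul_def] using key

lemma kappa_surjective : Function.Surjective p.kappa :=
  (antipode_bijective k H).2.comp p.modularTwist_surjective

/-- `Λ₁ h ⊗ Λ₂ = Λ₁ ⊗ Λ₂ κ(h)`. -/
lemma comul_mul_tmul_one (h : H) :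
    comul (R := k) Λ * (h ⊗ₜ[k] 1) = comul (R := k) Λ * (1 ⊗ₜ[k] p.kappa h) := by
  rw [← sum_comul_mul_one_tmul_antipode (ℛ k h), p.kappa_eq_sum (ℛ k h), Finset.mul_sum]
  simp only [← mul_assoc, ← Bialgebra.comul_mul, p.self_mul, map_smul, smul_mul_assoc, tmul_sum,
    tmul_smul, Finset.mul_sum, mul_smul_comm]

/-- The Nakayama automorphism of the Frobenius form `t` is `κ ∘ S`. -/
lemma apply_mul_comm (x y : H) : t (x * y) = t (y * p.kappa (antipode k x)) := by
  have h : t ∘ₗ LinearMap.mulLeft k x =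
      t ∘ₗ LinearMap.mulRight k (p.kappa (antipode k x)) := by
    apply p.isLeftIntegral.ext_slice_comul p.ne_zero
    have h1 := slice_tmul_mul t (antipode k x) 1 (comul (R := k) Λ)
    rw [p.comul_mul_tmul_one, slice_tmul_mul, mul_one, LinearMap.mulRight_one, LinearMap.comp_id,
      p.slice_comul, one_mul] at h1
    rw [p.slice_comul_mulLeft, h1]
  exact congr($h y)

/-- The indicator in terms of integrals. -/
lemma indicator_eq (p : IsIntegralPair Λ t) (n : ℤ) :
    indicator k H n = t (sweedlerPow k H n Λ) := by
  have h : antipode k ∘ₗ sweedlerPow k H (n - 1) = ∑ i ∈ (ℛ k Λ).index,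
      (t ∘ₗ LinearMap.mulRight k ((ℛ k Λ).right i) ∘ₗ
        sweedlerPow k H (n - 1)).smulRight ((ℛ k Λ).left i) := by
    ext y
    rw [LinearMap.comp_apply, ← p.slice_comul_mulLeft, ← (ℛ k Λ).eq]
    simp
  have h2 : sweedlerPow k H n Λ =
      ∑ i ∈ (ℛ k Λ).index, sweedlerPow k H (n - 1) ((ℛ k Λ).left i) * (ℛ k Λ).right i := by
    have : (idUnit k H ^ n : (WithConv (H →ₗ[k] H))ˣ) = idUnit k H ^ (n - 1) * idUnit k H := by
      rw [← zpow_add_one, sub_add_cancel]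
    rw [sweedlerPow, this, Units.val_mul]
    exact (ℛ k Λ).convMul_apply _ _
  rw [indicator, h, h2, map_sum, map_sum]
  simp

end IsIntegralPair

end Frobenius

/-! ### Iterated products of a comultiplication -/

section IteratedProduct

variable {k A : Type*} [Field k] [Ring A] [Algebra k A]

/-- The product `x₁ x₂ ⋯ xₘ₊₁` of the components of the iterated comultiplication, for a linear
map `D : A → A ⊗ A` in place of the comultiplication. -/
noncomputable def itMul (D : A →ₗ[k] A ⊗[k] A) : ℕ → (A →ₗ[k] A)
  | 0 => LinearMap.id
  | m + 1 => LinearMap.mul' k A ∘ₗ (itMul D m).lTensor A ∘ₗ D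

/-- The product `xₘ₊₁ ⋯ x₂ x₁` of the components of the iterated comultiplication in opposite
order, for a linear map `D : A → A ⊗ A` in place of the comultiplication. -/
noncomputable def itMulOp (D : A →ₗ[k] A ⊗[k] A) : ℕ → (A →ₗ[k] A)
  | 0 => LinearMap.id
  | m + 1 => LinearMap.mul' k A ∘ₗ (TensorProduct.comm k A A).toLinearMap ∘ₗ
      (itMulOp D m).lTensor A ∘ₗ D

end IteratedProduct

/-! ### Tensor powers and the iterated twist -/

section Stage

variable {k H : Type*} [Field k] [Ring H] [HopfAlgebra k H]

section

variable {B : Type*} [Ring B] [Algebra k B]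

/-- For `μ : B → H`, the map `h ⊗ b ↦ h μ(b)`. -/
noncomputable def mulLift (μ : B →ₗ[k] H) : H ⊗[k] B →ₗ[k] H :=
  LinearMap.mul' k H ∘ₗ μ.lTensor H

/-- For `ν : B → H`, the map `h ⊗ b ↦ ν(b) h`. -/
noncomputable def mulLiftOp (ν : B →ₗ[k] H) : H ⊗[k] B →ₗ[k] H :=
  LinearMap.mul' k H ∘ₗ (TensorProduct.comm k H H).toLinearMap ∘ₗ ν.lTensor H

@[simp] lemma mulLift_tmul (μ : B →ₗ[k] H) (h : H) (b : B) :
    mulLift μ (h ⊗ₜ[k] b) = h * μ b := rfl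

@[simp] lemma mulLiftOp_tmul (ν : B →ₗ[k] H) (h : H) (b : B) :
    mulLiftOp ν (h ⊗ₜ[k] b) = ν b * h := rfl

lemma mulLift_tmul_one_mul (μ : B →ₗ[k] H) (h : H) (c : H ⊗[k] B) :
    mulLift μ ((h ⊗ₜ[k] 1) * c) = h * mulLift μ c := by
  induction c with
  | zero => simp
  | tmul a b => simp [mul_assoc]
  | add x y hx hy => simp only [mul_add, map_add, hx, hy]

lemma mulLiftOp_mul_tmul_one (ν : B →ₗ[k] H) (h : H) (c : H ⊗[k] B) :
    mulLiftOp ν (c * (h ⊗ₜ[k] 1)) = mulLiftOp ν c * h := by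
  induction c with
  | zero => simp
  | tmul a b => simp [mul_assoc]
  | add x y hx hy => simp only [add_mul, map_add, hx, hy]

end

/-- The structure of the tensor power `B = H^{⊗ (m+1)}` that is used to compare iterated products
with respect to `Δ` and `Δ_F`: the iterated comultiplication `δ : H → B`, the unit `G` of `B` that
conjugates `δ` into the iterate of `Δ_F`, the multiplication maps `μ`, `ν : B → H` in the given and
in the opposite order, and the regrouping isomorphism `R : B ⊗ H → H ⊗ B`. The fields `μ_rotate` and
`ν_rotate` say that factors can be moved by one position: in the given order, multiplying the last
`m + 1` components by `w` from the left has the same effect on the product as multiplying the first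
`m + 1` components by `w` from the right; in the opposite order, the two sides are exchanged. -/
structure PowerStage (F : (H ⊗[k] H)ˣ) (m : ℕ) (B : Type*) [Ring B] [Algebra k B] where
  δ : H →ₐ[k] B
  G : Bˣ
  μ : B →ₗ[k] H
  ν : B →ₗ[k] H
  R : B ⊗[k] H →ₐ[k] H ⊗[k] B
  R_comul (x : H) : R (Algebra.TensorProduct.map δ (AlgHom.id k H) (comul x)) =
    Algebra.TensorProduct.map (AlgHom.id k H) δ (comul x)
  R_twist : R (((G : B) ⊗ₜ[k] 1) * Algebra.TensorProduct.map δ (AlgHom.id k H) F) =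
    ((1 : H) ⊗ₜ[k] (G : B)) * Algebra.TensorProduct.map (AlgHom.id k H) δ F
  μ_rotate (w : B) (c : H ⊗[k] B) : mulLift μ ((1 ⊗ₜ w) * c) = mulLift μ (c * R (w ⊗ₜ 1))
  ν_rotate (w : B) (c : H ⊗[k] B) : mulLiftOp ν (R (w ⊗ₜ 1) * c) = mulLiftOp ν (c * (1 ⊗ₜ w))
  μ_mul (c : H ⊗[k] B) (h : H) : mulLift μ (c * R (1 ⊗ₜ h)) = mulLift μ c * h
  mul_ν (c : H ⊗[k] B) (h : H) : mulLiftOp ν (R (1 ⊗ₜ h) * c) = h * mulLiftOp ν c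
  μ_δ (x : H) : μ (δ x) = itMul (comul (R := k)) m x
  ν_δ (x : H) : ν (δ x) = itMulOp (comul (R := k)) m x
  μ_conj (x : H) : μ (G * δ x * (G⁻¹ : Bˣ)) = itMul (twistedComul F).toLinearMap m x
  ν_conj (x : H) : ν (G * δ x * (G⁻¹ : Bˣ)) = itMulOp (twistedComul F).toLinearMap m x

namespace PowerStage

variable {F : (H ⊗[k] H)ˣ}

/-- The stage `B = H`. -/
noncomputable def base (F : (H ⊗[k] H)ˣ) : PowerStage F 0 H where
  δ := AlgHom.id k H
  G := 1
  μ := LinearMap.id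
  ν := LinearMap.id
  R := AlgHom.id k _
  R_comul x := rfl
  R_twist := by simp
  μ_rotate w c := by
    induction c with
    | zero => simp
    | tmul a b => simp [mul_assoc]
    | add x y hx hy => simp only [mul_add, add_mul, map_add, hx, hy]
  ν_rotate w c := by
    induction c with
    | zero => simp
    | tmul a b => simp [mul_assoc]
    | add x y hx hy => simp only [mul_add, add_mul, map_add, hx, hy]
  μ_mul c h := by
    induction c with
    | zero => simp
    | tmul a b => simp [mul_assoc]
    | add x y hx hy => simp only [add_mul, map_add, hx, hy]
  mul_ν c h := by
    induction c with
    | zero => simp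
    | tmul a b => simp [mul_assoc]
    | add x y hx hy => simp only [mul_add, map_add, hx, hy]
  μ_δ x := rfl
  ν_δ x := rfl
  μ_conj x := by simp [itMul]
  ν_conj x := by simp [itMulOp]

variable {m : ℕ} {B : Type*} [Ring B] [Algebra k B]

lemma itMul_succ (s : PowerStage F m B) (x : H) :
    itMul (comul (R := k)) (m + 1) x =
      mulLift s.μ (Algebra.TensorProduct.map (AlgHom.id k H) s.δ (comul x)) := by
  rw [itMul, LinearMap.comp_apply, LinearMap.comp_apply]
  induction comul (R := k) x with
  | zero => simp
  | tmul a b => simp [s.μ_δ]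
  | add x y hx hy => simp only [map_add, hx, hy]

lemma itMulOp_succ (s : PowerStage F m B) (x : H) :
    itMulOp (comul (R := k)) (m + 1) x =
      mulLiftOp s.ν (Algebra.TensorProduct.map (AlgHom.id k H) s.δ (comul x)) := by
  rw [itMulOp, LinearMap.comp_apply, LinearMap.comp_apply, LinearMap.comp_apply]
  induction comul (R := k) x with
  | zero => simp
  | tmul a b => simp [s.ν_δ]
  | add x y hx hy => simp only [map_add, hx, hy]

lemma itMul_twisted_succ (s : PowerStage F m B) (x : H) :
    itMul (twistedComul F).toLinearMap (m + 1) x = mulLift s.μ (((1 : H) ⊗ₜ[k] (s.G : B)) *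
      Algebra.TensorProduct.map (AlgHom.id k H) s.δ (twistedComul F x) *
        (1 ⊗ₜ[k] ((s.G⁻¹ : Bˣ) : B))) := by
  rw [itMul, LinearMap.comp_apply, LinearMap.comp_apply, AlgHom.toLinearMap_apply]
  induction twistedComul F x with
  | zero => simp
  | tmul a b => simp [s.μ_conj]
  | add x y hx hy => simp only [mul_add, add_mul, map_add, hx, hy]

lemma itMulOp_twisted_succ (s : PowerStage F m B) (x : H) :
    itMulOp (twistedComul F).toLinearMap (m + 1) x = mulLiftOp s.ν (((1 : H) ⊗ₜ[k] (s.G : B)) *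
      Algebra.TensorProduct.map (AlgHom.id k H) s.δ (twistedComul F x) *
        (1 ⊗ₜ[k] ((s.G⁻¹ : Bˣ) : B))) := by
  rw [itMulOp, LinearMap.comp_apply, LinearMap.comp_apply, LinearMap.comp_apply,
    AlgHom.toLinearMap_apply]
  induction twistedComul F x with
  | zero => simp
  | tmul a b => simp [s.ν_conj]
  | add x y hx hy => simp only [mul_add, add_mul, map_add, hx, hy]

/-- The comultiplication `(id ⊗ δ) Δ` of the next stage. -/
noncomputable def succδ (s : PowerStage F m B) : H →ₐ[k] H ⊗[k] B :=
  (Algebra.TensorProduct.map (AlgHom.id k H) s.δ).comp (Bialgebra.comulAlgHom k H)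

/-- The regrouping map of the next stage. -/
noncomputable def succR (s : PowerStage F m B) : (H ⊗[k] B) ⊗[k] H →ₐ[k] H ⊗[k] (H ⊗[k] B) :=
  (Algebra.TensorProduct.map (AlgHom.id k H) s.R).comp
    (Algebra.TensorProduct.assoc k k k H B H).toAlgHom

/-- The unit `(1 ⊗ G) (id ⊗ δ)(F)` of the next stage. -/
noncomputable def succG (s : PowerStage F m B) : (H ⊗[k] B)ˣ :=
  Units.map (Algebra.TensorProduct.includeRight (R := k) (A := H) (B := B)).toMonoidHom s.G *
    Units.map (Algebra.TensorProduct.map (AlgHom.id k H) s.δ).toMonoidHom F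

lemma succG_val (s : PowerStage F m B) : (s.succG : H ⊗[k] B) =
    ((1 : H) ⊗ₜ[k] (s.G : B)) * Algebra.TensorProduct.map (AlgHom.id k H) s.δ F := rfl

lemma succG_inv_val (s : PowerStage F m B) : ((s.succG⁻¹ : (H ⊗[k] B)ˣ) : H ⊗[k] B) =
    Algebra.TensorProduct.map (AlgHom.id k H) s.δ ((F⁻¹ : (H ⊗[k] H)ˣ) : H ⊗[k] H) *
      ((1 : H) ⊗ₜ[k] ((s.G⁻¹ : Bˣ) : B)) := by
  rw [succG, mul_inv_rev]
  rfl

lemma succG_conj (s : PowerStage F m B) (x : H) :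
    (s.succG : H ⊗[k] B) * s.succδ x * ((s.succG⁻¹ : (H ⊗[k] B)ˣ) : H ⊗[k] B) =
      ((1 : H) ⊗ₜ[k] (s.G : B)) *
      Algebra.TensorProduct.map (AlgHom.id k H) s.δ (twistedComul F x) *
        (1 ⊗ₜ[k] ((s.G⁻¹ : Bˣ) : B)) := by
  have h : twistedComul F x = F * comul (R := k) x * ((F⁻¹ : (H ⊗[k] H)ˣ) : H ⊗[k] H) := by
    simp [twistedComul, mul_assoc]
  rw [succG_val, succG_inv_val, h, map_mul, map_mul]
  simp only [succδ, AlgHom.comp_apply, Bialgebra.comulAlgHom_apply, mul_assoc]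

lemma succR_tmul (s : PowerStage F m B) (h : H) (b : B) (x : H) :
    s.succR ((h ⊗ₜ[k] b) ⊗ₜ[k] x) = h ⊗ₜ[k] s.R (b ⊗ₜ[k] x) := rfl

/-- The common extension `id ⊗ R (δ ⊗ id)` through which regrouping is compared with `assoc`. -/
noncomputable def regroup (s : PowerStage F m B) : H ⊗[k] (H ⊗[k] H) →ₐ[k] H ⊗[k] (H ⊗[k] B) :=
  Algebra.TensorProduct.map (AlgHom.id k H)
    (s.R.comp (Algebra.TensorProduct.map s.δ (AlgHom.id k H)))

lemma regroup_assoc_tmul (s : PowerStage F m B) (X : H ⊗[k] H) (y : H) :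
    s.regroup (Algebra.TensorProduct.assoc k k k H H H (X ⊗ₜ[k] y)) =
      s.succR (Algebra.TensorProduct.map (AlgHom.id k H) s.δ X ⊗ₜ[k] y) := by
  induction X with
  | zero => simp
  | tmul a b => simp [regroup, succR]
  | add x y hx hy => simp only [map_add, add_tmul, hx, hy]

lemma regroup_assoc_comul (s : PowerStage F m B) (X : H ⊗[k] H) :
    s.regroup (Algebra.TensorProduct.assoc k k k H H H
      (Algebra.TensorProduct.map (Bialgebra.comulAlgHom k H) (AlgHom.id k H) X)) =
      s.succR (Algebra.TensorProduct.map s.succδ (AlgHom.id k H) X) := by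
  induction X with
  | zero => simp
  | tmul a b =>
    rw [Algebra.TensorProduct.map_tmul, regroup_assoc_tmul]
    rfl
  | add x y hx hy => simp only [map_add, hx, hy]

lemma regroup_one_tmul (s : PowerStage F m B) (X : H ⊗[k] H) :
    s.regroup ((1 : H) ⊗ₜ[k] X) =
      1 ⊗ₜ[k] s.R (Algebra.TensorProduct.map s.δ (AlgHom.id k H) X) := by
  simp [regroup]

lemma regroup_comul (s : PowerStage F m B) (X : H ⊗[k] H) :
    s.regroup (Algebra.TensorProduct.map (AlgHom.id k H) (Bialgebra.comulAlgHom k H) X) =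
      Algebra.TensorProduct.map (AlgHom.id k H) s.succδ X := by
  induction X with
  | zero => simp
  | tmul a b => simp [regroup, succδ, s.R_comul]
  | add x y hx hy => simp only [map_add, hx, hy]

/-- The stage `H ⊗ B` following `B`. -/
noncomputable def succ (hF : IsTwist F) (s : PowerStage F m B) :
    PowerStage F (m + 1) (H ⊗[k] B) where
  δ := s.succδ
  G := s.succG
  μ := mulLift s.μ
  ν := mulLiftOp s.ν
  R := s.succR
  R_comul x := by
    rw [← regroup_assoc_comul, ← regroup_comul]
    congr 1
    exact coassoc_apply x
  R_twist := by
    rw [map_mul, ← regroup_assoc_comul, succG_val, ← one_mul (1 : H),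
      ← Algebra.TensorProduct.tmul_mul_tmul, map_mul, succR_tmul, ← regroup_assoc_tmul, mul_assoc,
      ← map_mul, ← map_mul, hF.cocycle, map_mul, regroup_one_tmul, regroup_comul, ← mul_assoc,
      Algebra.TensorProduct.tmul_mul_tmul, ← map_mul, s.R_twist]
    simp
  μ_rotate w c := by
    induction w with
    | zero => simp
    | add x y hx hy => simp only [tmul_add, add_tmul, map_add, add_mul, mul_add, hx, hy]
    | tmul w₁ w₂ =>
      induction c with
      | zero => simp
      | add x y hx hy => simp only [map_add, add_mul, mul_add, hx, hy]
      | tmul a c =>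
        have : (w₁ ⊗ₜ[k] w₂) * c = (w₁ ⊗ₜ[k] 1) * ((1 ⊗ₜ[k] w₂) * c) := by
          rw [← mul_assoc]; simp
        rw [succR_tmul, Algebra.TensorProduct.tmul_mul_tmul, Algebra.TensorProduct.tmul_mul_tmul,
          mulLift_tmul, mulLift_tmul, ← s.μ_rotate, this, mulLift_tmul_one_mul, one_mul, mul_assoc]
  ν_rotate w c := by
    induction w with
    | zero => simp
    | add x y hx hy => simp only [tmul_add, add_tmul, map_add, add_mul, mul_add, hx, hy]
    | tmul w₁ w₂ =>
      induction c with
      | zero => simp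
      | add x y hx hy => simp only [map_add, add_mul, mul_add, hx, hy]
      | tmul a c =>
        have : c * (w₁ ⊗ₜ[k] w₂) = (c * (1 ⊗ₜ[k] w₂)) * (w₁ ⊗ₜ[k] 1) := by
          rw [mul_assoc]; simp
        rw [succR_tmul, Algebra.TensorProduct.tmul_mul_tmul, Algebra.TensorProduct.tmul_mul_tmul,
          mulLiftOp_tmul, mulLiftOp_tmul, s.ν_rotate, this, mulLiftOp_mul_tmul_one, mul_one,
          mul_assoc]
  μ_mul c h := by
    induction c with
    | zero => simp
    | add x y hx hy => simp only [map_add, add_mul, hx, hy]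
    | tmul a c =>
      rw [Algebra.TensorProduct.one_def, succR_tmul, Algebra.TensorProduct.tmul_mul_tmul,
        mulLift_tmul, mulLift_tmul, s.μ_mul, mul_one, mul_assoc]
  mul_ν c h := by
    induction c with
    | zero => simp
    | add x y hx hy => simp only [map_add, mul_add, hx, hy]
    | tmul a c =>
      rw [Algebra.TensorProduct.one_def, succR_tmul, Algebra.TensorProduct.tmul_mul_tmul,
        mulLiftOp_tmul, mulLiftOp_tmul, s.mul_ν, one_mul, mul_assoc]
  μ_δ x := (s.itMul_succ x).symm
  ν_δ x := (s.itMulOp_succ x).symm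
  μ_conj x := by rw [s.succG_conj, s.itMul_twisted_succ]
  ν_conj x := by rw [s.succG_conj, s.itMulOp_twisted_succ]

/-- The relation of `G` to the twist, read off for the inverses. -/
lemma R_twist_inv (s : PowerStage F m B) :
    s.R (Algebra.TensorProduct.map s.δ (AlgHom.id k H) ((F⁻¹ : (H ⊗[k] H)ˣ) : H ⊗[k] H)) *
        s.R (((s.G⁻¹ : Bˣ) : B) ⊗ₜ[k] 1) =
      Algebra.TensorProduct.map (AlgHom.id k H) s.δ ((F⁻¹ : (H ⊗[k] H)ˣ) : H ⊗[k] H) *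
        (1 ⊗ₜ[k] ((s.G⁻¹ : Bˣ) : B)) := by
  have h1 : (((1 : H) ⊗ₜ[k] (s.G : B)) * Algebra.TensorProduct.map (AlgHom.id k H) s.δ F) *
      (Algebra.TensorProduct.map (AlgHom.id k H) s.δ ((F⁻¹ : (H ⊗[k] H)ˣ) : H ⊗[k] H) *
        (1 ⊗ₜ[k] ((s.G⁻¹ : Bˣ) : B))) = 1 := by
    rw [← succG_inv_val, ← succG_val, Units.mul_inv]
  have h2 : s.R (Algebra.TensorProduct.map s.δ (AlgHom.id k H)
        ((F⁻¹ : (H ⊗[k] H)ˣ) : H ⊗[k] H)) * s.R (((s.G⁻¹ : Bˣ) : B) ⊗ₜ[k] 1) *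
      (((1 : H) ⊗ₜ[k] (s.G : B)) * Algebra.TensorProduct.map (AlgHom.id k H) s.δ F) = 1 := by
    rw [← s.R_twist, ← map_mul, ← map_mul, mul_assoc, ← mul_assoc (_ ⊗ₜ[k] _),
      Algebra.TensorProduct.tmul_mul_tmul]
    simp only [Units.inv_mul, mul_one, ← Algebra.TensorProduct.one_def, one_mul, ← map_mul,
      map_one]
  exact left_inv_eq_right_inv h2 h1

/-- If the factors of `F Δ(x)` and `Δ(x) F⁻¹` can be collected on the outside, then so can those
of the iterated product with respect to `Δ_F`. -/
lemma itMul_twisted (s : PowerStage F m B) {x b c : H}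
    (h₁ : (F : H ⊗[k] H) * comul (R := k) x = (b ⊗ₜ 1) * comul (R := k) x)
    (h₂ : comul (R := k) x * ((F⁻¹ : (H ⊗[k] H)ˣ) : H ⊗[k] H) = comul (R := k) x * (1 ⊗ₜ c)) :
    itMul (twistedComul F).toLinearMap (m + 1) x =
      b * itMul (comul (R := k)) (m + 1) x * c := by
  have h : twistedComul F x = (b ⊗ₜ 1) * (comul (R := k) x *
      ((F⁻¹ : (H ⊗[k] H)ˣ) : H ⊗[k] H)) := by
    rw [← mul_assoc, ← h₁]
    simp [twistedComul, mul_assoc]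
  have h₃ := congr(s.R (Algebra.TensorProduct.map s.δ (AlgHom.id k H) $h₂))
  rw [map_mul, map_mul, s.R_comul, map_mul, map_mul, s.R_comul] at h₃
  simp only [Algebra.TensorProduct.map_tmul, map_one, AlgHom.id_apply] at h₃
  have h₄ : ((1 : H) ⊗ₜ[k] (s.G : B)) *
      Algebra.TensorProduct.map (AlgHom.id k H) s.δ (twistedComul F x) *
        (1 ⊗ₜ[k] ((s.G⁻¹ : Bˣ) : B)) = ((1 : H) ⊗ₜ[k] (s.G : B)) * ((b ⊗ₜ[k] (1 : B)) *
      (Algebra.TensorProduct.map (AlgHom.id k H) s.δ (comul x) * s.R (1 ⊗ₜ c))) *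
        s.R (((s.G⁻¹ : Bˣ) : B) ⊗ₜ[k] 1) := by
    rw [← h₃, h, map_mul, map_mul]
    simp only [mul_assoc, s.R_twist_inv, Algebra.TensorProduct.map_tmul, AlgHom.id_apply, map_one]
  rw [s.itMul_twisted_succ, s.itMul_succ, h₄, ← s.μ_rotate, ← mul_assoc,
    Algebra.TensorProduct.tmul_mul_tmul, Units.inv_mul, one_mul, ← Algebra.TensorProduct.one_def,
    one_mul, mulLift_tmul_one_mul, s.μ_mul, mul_assoc]

/-- The counterpart of `itMul_twisted` for products in opposite order. -/
lemma itMulOp_twisted (s : PowerStage F m B) {x b c : H}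
    (h₁ : (F : H ⊗[k] H) * comul (R := k) x = (1 ⊗ₜ b) * comul (R := k) x)
    (h₂ : comul (R := k) x * ((F⁻¹ : (H ⊗[k] H)ˣ) : H ⊗[k] H) = comul (R := k) x * (c ⊗ₜ 1)) :
    itMulOp (twistedComul F).toLinearMap (m + 1) x =
      b * itMulOp (comul (R := k)) (m + 1) x * c := by
  have h : twistedComul F x = (F : H ⊗[k] H) * (comul (R := k) x * (c ⊗ₜ 1)) := by
    rw [← h₂]
    simp [twistedComul]
  have h₃ := congr(s.R (Algebra.TensorProduct.map s.δ (AlgHom.id k H) $h₁))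
  rw [map_mul, map_mul, s.R_comul, map_mul, map_mul, s.R_comul] at h₃
  simp only [Algebra.TensorProduct.map_tmul, map_one, AlgHom.id_apply] at h₃
  have h₄ : ((1 : H) ⊗ₜ[k] (s.G : B)) *
      Algebra.TensorProduct.map (AlgHom.id k H) s.δ (twistedComul F x) *
        (1 ⊗ₜ[k] ((s.G⁻¹ : Bˣ) : B)) = s.R ((s.G : B) ⊗ₜ[k] 1) * (s.R (1 ⊗ₜ b) *
      Algebra.TensorProduct.map (AlgHom.id k H) s.δ (comul x) * (c ⊗ₜ[k] (1 : B)) *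
        (1 ⊗ₜ[k] ((s.G⁻¹ : Bˣ) : B))) := by
    rw [← h₃, h, map_mul, ← mul_assoc (1 ⊗ₜ[k] (s.G : B)), ← s.R_twist, map_mul, map_mul]
    simp only [mul_assoc, Algebra.TensorProduct.map_tmul, AlgHom.id_apply, map_one]
  rw [s.itMulOp_twisted_succ, s.itMulOp_succ, h₄, s.ν_rotate, mul_assoc,
    Algebra.TensorProduct.tmul_mul_tmul, Units.inv_mul, one_mul, ← Algebra.TensorProduct.one_def,
    mul_one, mulLiftOp_mul_tmul_one, s.mul_ν]

lemma mul_itMul (s : PowerStage F m B) {x a b c : H}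
    (h₁ : (a ⊗ₜ 1) * comul (R := k) x = (1 ⊗ₜ b) * comul (R := k) x)
    (h₂ : comul (R := k) x * (b ⊗ₜ 1) = comul (R := k) x * (1 ⊗ₜ c)) :
    a * itMul (comul (R := k)) (m + 1) x = itMul (comul (R := k)) (m + 1) x * c := by
  have h₁' := congr(Algebra.TensorProduct.map (AlgHom.id k H) s.δ $h₁)
  have h₂' := congr(s.R (Algebra.TensorProduct.map s.δ (AlgHom.id k H) $h₂))
  simp only [map_mul, Algebra.TensorProduct.map_tmul, map_one, AlgHom.id_apply, s.R_comul]
    at h₁' h₂'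
  rw [s.itMul_succ, ← mulLift_tmul_one_mul, h₁', s.μ_rotate, h₂', s.μ_mul]

lemma itMulOp_mul (s : PowerStage F m B) {x a b c : H}
    (h₁ : comul (R := k) x * (a ⊗ₜ 1) = comul (R := k) x * (1 ⊗ₜ b))
    (h₂ : (b ⊗ₜ 1) * comul (R := k) x = (1 ⊗ₜ c) * comul (R := k) x) :
    itMulOp (comul (R := k)) (m + 1) x * a = c * itMulOp (comul (R := k)) (m + 1) x := by
  have h₁' := congr(Algebra.TensorProduct.map (AlgHom.id k H) s.δ $h₁)
  have h₂' := congr(s.R (Algebra.TensorProduct.map s.δ (AlgHom.id k H) $h₂))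
  simp only [map_mul, Algebra.TensorProduct.map_tmul, map_one, AlgHom.id_apply, s.R_comul]
    at h₁' h₂'
  rw [s.itMulOp_succ, ← mulLiftOp_mul_tmul_one, h₁', ← s.ν_rotate, h₂', s.mul_ν]

end PowerStage

/-- Every tensor power `H^{⊗ (m+1)}` carries a stage. -/
lemma exists_powerStage.{u, v} {k : Type u} {H : Type v} [Field k] [Ring H] [HopfAlgebra k H]
    {F : (H ⊗[k] H)ˣ} (hF : IsTwist F) (m : ℕ) :
    ∃ (B : Type v) (_ : Ring B) (_ : Algebra k B), Nonempty (PowerStage F m B) := by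
  induction m with
  | zero => exact ⟨H, inferInstance, inferInstance, ⟨PowerStage.base F⟩⟩
  | succ m ih =>
    obtain ⟨B, _, _, ⟨s⟩⟩ := ih
    exact ⟨H ⊗[k] B, inferInstance, inferInstance, ⟨s.succ hF⟩⟩

end Stage

/-! ### Sweedler powers as iterated products -/

section SweedlerPower

variable (k H : Type*) [Field k] [Ring H] [HopfAlgebra k H]

lemma sweedlerPow_zero_apply (x : H) : sweedlerPow k H 0 x = algebraMap k H (counit x) := by
  rw [sweedlerPow, zpow_zero]
  rfl

lemma sweedlerPow_natCast_add_one (m : ℕ) :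
    sweedlerPow k H (m + 1) = itMul (comul (R := k)) m := by
  induction m with
  | zero =>
    rw [sweedlerPow, Nat.cast_zero, zero_add, zpow_one]
    rfl
  | succ m ih =>
    rw [sweedlerPow, Nat.cast_add_one, add_comm _ (1 : ℤ), zpow_one_add, Units.val_mul, itMul, ← ih]
    rfl

lemma sweedlerPow_neg_natCast_add_one (m : ℕ) :
    sweedlerPow k H (-(m + 1)) = antipode k ∘ₗ itMulOp (comul (R := k)) m := by
  induction m with
  | zero =>
    rw [sweedlerPow, Nat.cast_zero, zero_add, zpow_neg_one]
    rfl
  | succ m ih =>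
    have h : (idUnit k H ^ (-((m + 1 : ℕ) + 1 : ℤ)) : (WithConv (H →ₗ[k] H))ˣ) =
        (idUnit k H)⁻¹ * idUnit k H ^ (-(m + 1) : ℤ) := by
      rw [← zpow_neg_one, ← zpow_add]
      congr 1
      push_cast
      ring
    ext x
    have h2 : sweedlerPow k H (-((m + 1 : ℕ) + 1)) x = ∑ i ∈ (ℛ k x).index,
        antipode k ((ℛ k x).left i) * sweedlerPow k H (-(m + 1)) ((ℛ k x).right i) := by
      rw [sweedlerPow, h, Units.val_mul]
      exact (ℛ k x).convMul_apply _ _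
    rw [h2, ih, itMulOp]
    simp only [LinearMap.comp_apply]
    rw [← (ℛ k x).eq]
    simp [antipode_mul_antidistrib]

end SweedlerPower

/-! ### Transport along algebra maps -/

section Transport

variable {k A A' : Type*} [Field k] [Ring A] [Algebra k A] [Ring A'] [Algebra k A']
  (e : A' →ₐ[k] A) {D' : A' →ₗ[k] A' ⊗[k] A'} {D : A →ₗ[k] A ⊗[k] A}

lemma map_itMul (h : ∀ x, TensorProduct.map e.toLinearMap e.toLinearMap (D' x) = D (e x)) (m : ℕ)
    (x : A') : e (itMul D' m x) = itMul D m (e x) := by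
  induction m generalizing x with
  | zero => rfl
  | succ m ih =>
    simp only [itMul, LinearMap.comp_apply, ← h]
    induction D' x with
    | zero => simp
    | tmul a b => simp [ih]
    | add x y hx hy => simp only [map_add, hx, hy]

lemma map_itMulOp (h : ∀ x, TensorProduct.map e.toLinearMap e.toLinearMap (D' x) = D (e x))
    (m : ℕ) (x : A') : e (itMulOp D' m x) = itMulOp D m (e x) := by
  induction m generalizing x with
  | zero => rfl
  | succ m ih =>
    simp only [itMulOp, LinearMap.comp_apply, ← h]
    induction D' x with
    | zero => simp
    | tmul a b => simp [ih]
    | add x y hx hy => simp only [map_add, hx, hy]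

end Transport

/-! ### The element `β` of a twist -/

section Twist

variable {k H : Type*} [Field k] [Ring H] [HopfAlgebra k H]

/-- The map `a ⊗ b ↦ a S(b)`. At a twist `F` its value is the element `β` with
`S_F(h) = β S(h) β⁻¹`. -/
noncomputable def mulAntipode : H ⊗[k] H →ₗ[k] H :=
  LinearMap.mul' k H ∘ₗ (antipode k).lTensor H

/-- The map `a ⊗ b ↦ S(a) b`. Its value at `F⁻¹` is the inverse of `mulAntipode F`. -/
noncomputable def antipodeMul : H ⊗[k] H →ₗ[k] H :=
  LinearMap.mul' k H ∘ₗ (antipode k).rTensor H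

@[simp] lemma mulAntipode_tmul (a b : H) : mulAntipode (a ⊗ₜ[k] b) = a * antipode k b := rfl

@[simp] lemma antipodeMul_tmul (a b : H) : antipodeMul (a ⊗ₜ[k] b) = antipode k a * b := rfl

@[simp] lemma mulAntipode_comul (a : H) :
    mulAntipode (comul (R := k) a) = algebraMap k H (counit a) :=
  mul_antipode_lTensor_comul_apply a

@[simp] lemma antipodeMul_comul (a : H) :
    antipodeMul (comul (R := k) a) = algebraMap k H (counit a) :=
  mul_antipode_rTensor_comul_apply a

variable {F : (H ⊗[k] H)ˣ}

lemma IsTwist.counit_left_inv (hF : IsTwist F) : Algebra.TensorProduct.lid k H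
    (Algebra.TensorProduct.map (Bialgebra.counitAlgHom k H) (AlgHom.id k H)
      ((F⁻¹ : (H ⊗[k] H)ˣ) : H ⊗[k] H)) = 1 := by
  have h := congr(Algebra.TensorProduct.lid k H (Algebra.TensorProduct.map
    (Bialgebra.counitAlgHom k H) (AlgHom.id k H) $(F.mul_inv)))
  rwa [map_mul, map_mul, hF.counit_left, one_mul, map_one, map_one] at h

lemma IsTwist.counit_right_inv (hF : IsTwist F) : Algebra.TensorProduct.rid k k H
    (Algebra.TensorProduct.map (AlgHom.id k H) (Bialgebra.counitAlgHom k H)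
      ((F⁻¹ : (H ⊗[k] H)ˣ) : H ⊗[k] H)) = 1 := by
  have h := congr(Algebra.TensorProduct.rid k k H (Algebra.TensorProduct.map
    (AlgHom.id k H) (Bialgebra.counitAlgHom k H) $(F.mul_inv)))
  rwa [map_mul, map_mul, hF.counit_right, one_mul, map_one, map_one] at h

/-- The map `a ⊗ b ⊗ c ↦ S(a) b S(c)` is applied to the cocycle equation, in the form
`(Δ ⊗ id)(F) (id ⊗ Δ)(F⁻¹) = (F⁻¹ ⊗ 1) (1 ⊗ F)`. -/
lemma IsTwist.antipodeMul_inv_mul_mulAntipode (hF : IsTwist F) :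
    antipodeMul ((F⁻¹ : (H ⊗[k] H)ˣ) : H ⊗[k] H) * mulAntipode (F : H ⊗[k] H) = 1 := by
  set f : H ⊗[k] H := ((F⁻¹ : (H ⊗[k] H)ˣ) : H ⊗[k] H) with hf
  let M : H ⊗[k] (H ⊗[k] H) →ₗ[k] H := LinearMap.mul' k H ∘ₗ
    TensorProduct.map (antipode k) mulAntipode
  have hM (Z W : H ⊗[k] H) (q u : H) :
      M (Algebra.TensorProduct.assoc k k k H H H (Z ⊗ₜ q) * (u ⊗ₜ[k] W)) =
        antipode k u * antipodeMul Z * mulAntipode W * antipode k q := by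
    induction Z with
    | zero => simp
    | add x y hx hy => simp only [add_tmul, map_add, add_mul, mul_add, hx, hy]
    | tmul z₁ z₂ =>
      induction W with
      | zero => simp
      | add x y hx hy => simp only [tmul_add, map_add, add_mul, mul_add, hx, hy]
      | tmul w₁ w₂ => simp [M, antipode_mul_antidistrib, mul_assoc]
  have h1 (X Y : H ⊗[k] H) : M (Algebra.TensorProduct.assoc k k k H H H (X ⊗ₜ 1) * (1 ⊗ₜ[k] Y)) =
      antipodeMul X * mulAntipode Y := by simp [hM]
  have h2 (X Y : H ⊗[k] H) : M (Algebra.TensorProduct.assoc k k k H H H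
      (Algebra.TensorProduct.map (Bialgebra.comulAlgHom k H) (AlgHom.id k H) X) *
      Algebra.TensorProduct.map (AlgHom.id k H) (Bialgebra.comulAlgHom k H) Y) =
      antipode k (Algebra.TensorProduct.rid k k H
        (Algebra.TensorProduct.map (AlgHom.id k H) (Bialgebra.counitAlgHom k H) Y)) *
      antipode k (Algebra.TensorProduct.lid k H
        (Algebra.TensorProduct.map (Bialgebra.counitAlgHom k H) (AlgHom.id k H) X)) := by
    induction X with
    | zero => simp
    | add x y hx hy => simp only [map_add, add_mul, mul_add, hx, hy]
    | tmul p q =>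
      induction Y with
      | zero => simp
      | add x y hx hy => simp only [map_add, add_mul, mul_add, hx, hy]
      | tmul u v =>
        simp [hM, Algebra.algebraMap_eq_smul_one, smul_smul, mul_comm]
  have hP : Algebra.TensorProduct.assoc k k k H H H (f ⊗ₜ 1) *
      Algebra.TensorProduct.assoc k k k H H H ((F : H ⊗[k] H) ⊗ₜ 1) = 1 := by
    rw [← map_mul, Algebra.TensorProduct.tmul_mul_tmul, hf, Units.inv_mul, one_mul,
      ← Algebra.TensorProduct.one_def, map_one]
  have hT : Algebra.TensorProduct.map (AlgHom.id k H) (Bialgebra.comulAlgHom k H) (F : H ⊗[k] H) *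
      Algebra.TensorProduct.map (AlgHom.id k H) (Bialgebra.comulAlgHom k H) f = 1 := by
    rw [← map_mul, hf, Units.mul_inv, map_one]
  have hc := hF.cocycle
  rw [map_mul] at hc
  have key : Algebra.TensorProduct.assoc k k k H H H
      (Algebra.TensorProduct.map (Bialgebra.comulAlgHom k H) (AlgHom.id k H) (F : H ⊗[k] H)) *
      Algebra.TensorProduct.map (AlgHom.id k H) (Bialgebra.comulAlgHom k H) f =
      Algebra.TensorProduct.assoc k k k H H H (f ⊗ₜ 1) * (1 ⊗ₜ[k] (F : H ⊗[k] H)) := by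
    rw [← one_mul (Algebra.TensorProduct.assoc k k k H H H
      (Algebra.TensorProduct.map (Bialgebra.comulAlgHom k H) (AlgHom.id k H) (F : H ⊗[k] H))),
      ← hP, mul_assoc, mul_assoc, ← mul_assoc _ _ (Algebra.TensorProduct.map _ _ f), hc,
      mul_assoc, hT, mul_one]
  rw [← h1, ← key, h2, hF.counit_left, hF.counit_right_inv]
  simp

end Twist

/-! ### Twisting the iterated products of an integral -/

section Invariance

variable {k H : Type*} [Field k] [Ring H] [HopfAlgebra k H]

lemma rid_map_counit_comul (x : H) : Algebra.TensorProduct.rid k k H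
    (Algebra.TensorProduct.map (AlgHom.id k H) (Bialgebra.counitAlgHom k H) (comul x)) = x := by
  change TensorProduct.rid k H (counit.lTensor H (comul x)) = x
  rw [lTensor_counit_comul, TensorProduct.rid_tmul, one_smul]

lemma lid_map_counit_comul (x : H) : Algebra.TensorProduct.lid k H
    (Algebra.TensorProduct.map (Bialgebra.counitAlgHom k H) (AlgHom.id k H) (comul x)) = x := by
  change TensorProduct.lid k H (counit.rTensor H (comul x)) = x
  rw [rTensor_counit_comul, TensorProduct.lid_tmul, one_smul]

lemma IsLeftIntegral.mul_comul {Λ : H} (hΛ : IsLeftIntegral k Λ) (X : H ⊗[k] H) :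
    X * comul (R := k) Λ = (mulAntipode X ⊗ₜ 1) * comul (R := k) Λ := by
  induction X with
  | zero => simp
  | add x y hx hy => simp only [add_mul, map_add, add_tmul, hx, hy]
  | tmul a b =>
    rw [← mul_one a, ← one_mul b, ← Algebra.TensorProduct.tmul_mul_tmul, mul_assoc,
      ← hΛ.antipode_tmul_one_mul_comul, ← mul_assoc]
    simp

lemma IsLeftIntegral.mulAntipode_mul_self {Λ : H} (hΛ : IsLeftIntegral k Λ)
    {F : (H ⊗[k] H)ˣ} (hF : IsTwist F) :
    mulAntipode (F : H ⊗[k] H) * Λ = Λ := by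
  have h := congr(Algebra.TensorProduct.rid k k H (Algebra.TensorProduct.map (AlgHom.id k H)
    (Bialgebra.counitAlgHom k H) $(hΛ.mul_comul (F : H ⊗[k] H))))
  have h' : Algebra.TensorProduct.rid k k H (Algebra.TensorProduct.map (AlgHom.id k H)
    (Bialgebra.counitAlgHom k H) (comul Λ)) = Λ :=
    rid_map_counit_comul Λ
  rw [map_mul, map_mul, map_mul, map_mul, hF.counit_right, h'] at h
  simpa using h.symm

variable [FiniteDimensional k H]

namespace IsIntegralPair

variable {Λ : H} {t : H →ₗ[k] k} (p : IsIntegralPair Λ t)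

/-- The map `a ⊗ b ↦ κ(a) b`. -/
noncomputable def kappaMul : H ⊗[k] H →ₗ[k] H := LinearMap.mul' k H ∘ₗ p.kappa.rTensor H

lemma comul_mul (X : H ⊗[k] H) :
    comul (R := k) Λ * X = comul (R := k) Λ * (1 ⊗ₜ p.kappaMul X) := by
  induction X with
  | zero => simp
  | add x y hx hy => simp only [mul_add, map_add, tmul_add, hx, hy]
  | tmul a b =>
    have h : a ⊗ₜ[k] b = (a ⊗ₜ[k] 1) * (1 ⊗ₜ[k] b) := by simp
    rw [h, ← mul_assoc, p.comul_mul_tmul_one, mul_assoc]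
    simp [kappaMul]

lemma modular_kappa (a : H) : p.modular (p.kappa a) = counit (R := k) a := by
  rw [p.kappa_eq_sum (ℛ k a), map_sum]
  simp only [map_smul, smul_eq_mul, ← map_mul, ← map_sum, sum_mul_antipode_eq_smul]
  simp

lemma counit_modularTwist (a : H) : counit (R := k) (p.modularTwist a) = p.modular a := by
  rw [p.modularTwist_eq_sum (ℛ k a), map_sum]
  conv_rhs => rw [← sum_counit_right_smul (ℛ k a)]
  simp [mul_comm]

variable {F : (H ⊗[k] H)ˣ}

lemma self_mul_kappaMul (hF : IsTwist F) :
    Λ * p.kappaMul ((F⁻¹ : (H ⊗[k] H)ˣ) : H ⊗[k] H) = Λ := by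
  have h := congr(Algebra.TensorProduct.lid k H (Algebra.TensorProduct.map
    (Bialgebra.counitAlgHom k H) (AlgHom.id k H)
      $(p.comul_mul ((F⁻¹ : (H ⊗[k] H)ˣ) : H ⊗[k] H))))
  have h' : Algebra.TensorProduct.lid k H (Algebra.TensorProduct.map
    (Bialgebra.counitAlgHom k H) (AlgHom.id k H) (comul Λ)) = Λ :=
    lid_map_counit_comul Λ
  rw [map_mul, map_mul, map_mul, map_mul, hF.counit_left_inv, h'] at h
  simpa using h.symm

lemma counit_kappaMul (hF : IsTwist F) :
    counit (R := k) (p.kappaMul ((F⁻¹ : (H ⊗[k] H)ˣ) : H ⊗[k] H)) = 1 := by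
  have h := congr(Algebra.TensorProduct.rid k k H (Algebra.TensorProduct.map
    (AlgHom.id k H) (Bialgebra.counitAlgHom k H)
      $(p.comul_mul ((F⁻¹ : (H ⊗[k] H)ˣ) : H ⊗[k] H))))
  rw [map_mul, map_mul, map_mul, map_mul, hF.counit_right_inv, rid_map_counit_comul] at h
  refine smul_left_injective k p.ne_zero ?_
  simpa [Algebra.smul_def, Algebra.commutes] using h.symm

/-- `S(a) y = y κ(a)` for `y = Λ₁ Λ₂ ⋯ Λₘ₊₁`. -/
lemma antipode_mul_itMul (hF : IsTwist F) (m : ℕ) (a : H) :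
    antipode k a * itMul (comul (R := k)) m Λ = itMul (comul (R := k)) m Λ * p.kappa a := by
  cases m with
  | zero => simp [itMul, p.isLeftIntegral _, p.self_mul, modular_kappa]
  | succ m =>
    obtain ⟨B, _, _, ⟨s⟩⟩ := exists_powerStage hF m
    exact s.mul_itMul (p.isLeftIntegral.antipode_tmul_one_mul_comul a) (p.comul_mul_tmul_one a)

/-- `q h = α(h₁) h₂ q` for `q = Λₘ₊₁ ⋯ Λ₂ Λ₁`. -/
lemma itMulOp_mul (hF : IsTwist F) (m : ℕ) (a : H) :
    itMulOp (comul (R := k)) m Λ * a = p.modularTwist a * itMulOp (comul (R := k)) m Λ := by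
  cases m with
  | zero => simp [itMulOp, p.isLeftIntegral _, p.self_mul, counit_modularTwist]
  | succ m =>
    obtain ⟨B, _, _, ⟨s⟩⟩ := exists_powerStage hF m
    exact s.itMulOp_mul (p.comul_mul_tmul_one a)
      (p.isLeftIntegral.antipode_tmul_one_mul_comul (p.modularTwist a))

lemma itMul_twisted (hF : IsTwist F) (m : ℕ) :
    itMul (twistedComul F).toLinearMap m Λ = mulAntipode (F : H ⊗[k] H) *
      itMul (comul (R := k)) m Λ * p.kappaMul ((F⁻¹ : (H ⊗[k] H)ˣ) : H ⊗[k] H) := by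
  cases m with
  | zero => simp [itMul, p.isLeftIntegral.mulAntipode_mul_self hF, p.self_mul_kappaMul hF]
  | succ m =>
    obtain ⟨B, _, _, ⟨s⟩⟩ := exists_powerStage hF m
    exact s.itMul_twisted (p.isLeftIntegral.mul_comul _) (p.comul_mul _)

lemma itMulOp_twisted (hF : IsTwist F) (m : ℕ) {b c : H}
    (hb : antipode k b = mulAntipode (F : H ⊗[k] H))
    (hc : p.kappa c = p.kappaMul ((F⁻¹ : (H ⊗[k] H)ˣ) : H ⊗[k] H)) :
    itMulOp (twistedComul F).toLinearMap m Λ = b * itMulOp (comul (R := k)) m Λ * c := by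
  have h₁ : (F : H ⊗[k] H) * comul (R := k) Λ = (1 ⊗ₜ b) * comul (R := k) Λ := by
    rw [p.isLeftIntegral.mul_comul, ← hb, p.isLeftIntegral.antipode_tmul_one_mul_comul]
  have h₂ : comul (R := k) Λ * ((F⁻¹ : (H ⊗[k] H)ˣ) : H ⊗[k] H) =
      comul (R := k) Λ * (c ⊗ₜ 1) := by
    rw [p.comul_mul, ← hc, p.comul_mul_tmul_one]
  cases m with
  | zero =>
    have hb' : counit (R := k) b = 1 := by
      rw [← counit_antipode, hb]
      have := p.isLeftIntegral.mulAntipode_mul_self hF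
      rw [p.isLeftIntegral] at this
      exact smul_left_injective k p.ne_zero (this.trans (one_smul k Λ).symm)
    have hc' : p.modular c = 1 := by
      rw [← p.counit_kappaMul hF, ← hc, kappa_apply, counit_antipode, counit_modularTwist]
    simp [itMulOp, p.isLeftIntegral b, p.self_mul, hb', hc']
  | succ m =>
    obtain ⟨B, _, _, ⟨s⟩⟩ := exists_powerStage hF m
    exact s.itMulOp_twisted h₁ h₂

end IsIntegralPair

end Invariance

/-! ### Comparison of the Frobenius forms -/

section Comparison

variable {k H : Type*} [Field k] [Ring H] [HopfAlgebra k H]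

lemma mulAntipode_tmul_mul (u v : H) (X : H ⊗[k] H) :
    mulAntipode ((u ⊗ₜ[k] v) * X) = u * mulAntipode X * antipode k v := by
  induction X with
  | zero => simp
  | add X Y hX hY => simp only [mul_add, map_add, add_mul, hX, hY]
  | tmul a b => simp [antipode_mul_antidistrib, mul_assoc]

variable [FiniteDimensional k H]

namespace IsIntegralPair

variable {Λ : H} {t : H →ₗ[k] k} (p : IsIntegralPair Λ t) {F : (H ⊗[k] H)ˣ}

/-- If `S(a) y = y κ(a)` for all `a`, then `t(· y)` is a trace twisted by `S²`, because `κ ∘ S` is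
the Nakayama automorphism of `t`. -/
lemma apply_mul_mul {y : H} (hy : ∀ a, antipode k a * y = y * p.kappa a) (a b : H) :
    t (a * b * y) = t (b * antipode k (antipode k a) * y) := by
  rw [mul_assoc, p.apply_mul_comm, mul_assoc, ← hy, mul_assoc]

/-- The twisted trace property turns `t(S⁻¹(S(u) v) β y)` into `t(u β S(v) y)`, and
`u β S(v)` is the image of `(u ⊗ v) F` under `a ⊗ b ↦ a S(b)`. -/
lemma apply_mul_mulAntipode_mul {y : H} (hy : ∀ a, antipode k a * y = y * p.kappa a) {w : H}
    (hw : antipode k w = antipodeMul ((F⁻¹ : (H ⊗[k] H)ˣ) : H ⊗[k] H)) :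
    t (w * mulAntipode (F : H ⊗[k] H) * y) = t y := by
  let σ : H ≃ₗ[k] H := LinearEquiv.ofBijective (antipode k) (antipode_bijective k H)
  have hσ (x : H) : antipode k (σ.symm x) = x := σ.apply_symm_apply x
  have key (X : H ⊗[k] H) : t (σ.symm (antipodeMul X) * mulAntipode (F : H ⊗[k] H) * y) =
      t (mulAntipode (X * (F : H ⊗[k] H)) * y) := by
    induction X with
    | zero => simp
    | add X Y hX hY => simp only [add_mul, map_add, hX, hY]
    | tmul u v =>
      have h : σ.symm (antipodeMul (u ⊗ₜ[k] v)) = σ.symm v * u := by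
        rw [LinearEquiv.symm_apply_eq]
        change _ = antipode k _
        rw [antipode_mul_antidistrib, hσ, antipodeMul_tmul]
      rw [h, mul_assoc (σ.symm v), p.apply_mul_mul hy, hσ, mulAntipode_tmul_mul]
  have h := key ((F⁻¹ : (H ⊗[k] H)ˣ) : H ⊗[k] H)
  rw [← hw, show σ.symm (antipode k w) = w from σ.symm_apply_apply w, Units.inv_mul,
    Algebra.TensorProduct.one_def, mulAntipode_tmul] at h
  simpa using h

lemma twistedComul_self :
    twistedComul F Λ = (mulAntipode (F : H ⊗[k] H) ⊗ₜ 1) * (comul (R := k) Λ *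
      (1 ⊗ₜ p.kappaMul ((F⁻¹ : (H ⊗[k] H)ˣ) : H ⊗[k] H))) := by
  change (F : H ⊗[k] H) * (comul Λ * ((F⁻¹ : (H ⊗[k] H)ˣ) : H ⊗[k] H)) = _
  rw [← mul_assoc, p.isLeftIntegral.mul_comul, mul_assoc, p.comul_mul]

variable {S' : H →ₗ[k] H} {t' : H →ₗ[k] k}

/-- Let `t'` be the Frobenius form and `S'` the antipode belonging to the integral `Λ` and the
comultiplication `Δ_F`. Then `t'(· b') = t(w ·)`, where `S(w)` is the inverse of `β`, and
`S' = β S(·) β⁻¹`. -/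
lemma exists_comp_mulRight_eq (hF : IsTwist F)
    (hS' : ∀ y, S' y = slice (t' ∘ₗ LinearMap.mulLeft k y) (twistedComul F Λ)) (h1 : S' 1 = 1) :
    ∃ w : H, antipode k w = antipodeMul ((F⁻¹ : (H ⊗[k] H)ˣ) : H ⊗[k] H) ∧
      mulAntipode (F : H ⊗[k] H) * antipode k w = 1 ∧
      (∀ y, t' (y * p.kappaMul ((F⁻¹ : (H ⊗[k] H)ˣ) : H ⊗[k] H)) = t (w * y)) ∧
      ∀ y, S' y = mulAntipode (F : H ⊗[k] H) * antipode k y * antipode k w := by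
  obtain ⟨w, hw⟩ := p.exists_eq_comp_mulLeft
    (t' ∘ₗ LinearMap.mulRight k (p.kappaMul ((F⁻¹ : (H ⊗[k] H)ˣ) : H ⊗[k] H)))
  have hS (y : H) : S' y = mulAntipode (F : H ⊗[k] H) * antipode k y * antipode k w := by
    have hcomp : (t' ∘ₗ LinearMap.mulLeft k y) ∘ₗ
        LinearMap.mulRight k (p.kappaMul ((F⁻¹ : (H ⊗[k] H)ˣ) : H ⊗[k] H)) =
        t ∘ₗ LinearMap.mulLeft k (w * y) := by
      ext x
      simpa [mul_assoc] using congr($hw (y * x))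
    rw [hS', p.twistedComul_self, slice_mul_tmul, LinearMap.mulLeft_one, LinearMap.comp_id,
      slice_tmul_mul, hcomp, p.slice_comul_mulLeft, mul_one, antipode_mul_antidistrib, mul_assoc]
  have h := hS 1
  rw [h1, antipode_one, mul_one] at h
  refine ⟨w, ?_, h.symm, fun y => congr($hw y), hS⟩
  exact (left_inv_eq_right_inv hF.antipodeMul_inv_mul_mulAntipode h.symm).symm

/-- If the counit does not vanish on `Λ`, then the modular function is trivial. -/
lemma kappa_eq_antipode (h : counit (R := k) Λ ≠ 0) (a : H) : p.kappa a = antipode k a := by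
  have hα (x : H) : p.modular x = counit x := by
    have h1 : Λ * (x * Λ) = Λ * x * Λ := (mul_assoc _ _ _).symm
    rw [p.isLeftIntegral x, p.self_mul x, mul_smul_comm, smul_mul_assoc, p.isLeftIntegral Λ,
      smul_smul, smul_smul] at h1
    exact (mul_right_cancel₀ h (smul_left_injective k p.ne_zero h1)).symm
  rw [kappa_apply, p.modularTwist_eq_sum (ℛ k a)]
  simp only [hα, sum_counit_smul]

lemma apply_itMul (p : IsIntegralPair Λ t) (hF : IsTwist F)
    (hS' : ∀ y, S' y = slice (t' ∘ₗ LinearMap.mulLeft k y) (twistedComul F Λ)) (h1 : S' 1 = 1)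
    (m : ℕ) : t' (itMul (twistedComul F).toLinearMap m Λ) = t (itMul (comul (R := k)) m Λ) := by
  obtain ⟨w, hw, -, ht, -⟩ := p.exists_comp_mulRight_eq hF hS' h1
  rw [p.itMul_twisted hF, ht, ← mul_assoc, p.apply_mul_mulAntipode_mul
    (p.antipode_mul_itMul hF m) hw]

lemma apply_antipode_itMulOp (p : IsIntegralPair Λ t) (hF : IsTwist F)
    (hS' : ∀ y, S' y = slice (t' ∘ₗ LinearMap.mulLeft k y) (twistedComul F Λ)) (h1 : S' 1 = 1)
    (m : ℕ) : t' (S' (itMulOp (twistedComul F).toLinearMap m Λ)) =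
      t (antipode k (itMulOp (comul (R := k)) m Λ)) := by
  obtain ⟨w, hw, hβ, ht, hS⟩ := p.exists_comp_mulRight_eq hF hS' h1
  obtain ⟨b, hb⟩ := (antipode_bijective k H).2 (mulAntipode (F : H ⊗[k] H))
  obtain ⟨c, hc⟩ := p.kappa_surjective (p.kappaMul ((F⁻¹ : (H ⊗[k] H)ˣ) : H ⊗[k] H))
  have hy (a : H) : antipode k a * antipode k (itMulOp (comul (R := k)) m Λ) =
      antipode k (itMulOp (comul (R := k)) m Λ) * p.kappa a := by
    rw [← antipode_mul_antidistrib, p.itMulOp_mul hF, antipode_mul_antidistrib, kappa_apply]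
  rw [p.itMulOp_twisted hF m hb hc, hS, antipode_mul_antidistrib, antipode_mul_antidistrib, hb,
    mul_assoc, mul_assoc, mul_assoc, hβ, mul_one, hy, hc, ← mul_assoc, ht, ← mul_assoc,
    p.apply_mul_mulAntipode_mul hy hw]

lemma apply_one_mul_counit (p : IsIntegralPair Λ t) (hF : IsTwist F)
    (hS' : ∀ y, S' y = slice (t' ∘ₗ LinearMap.mulLeft k y) (twistedComul F Λ)) (h1 : S' 1 = 1) :
    counit (R := k) Λ * t' 1 = counit Λ * t 1 := by
  by_cases h : counit (R := k) Λ = 0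
  · simp [h]
  obtain ⟨w, hw, hβ, ht, -⟩ := p.exists_comp_mulRight_eq hF hS' h1
  have hκ : p.kappaMul ((F⁻¹ : (H ⊗[k] H)ˣ) : H ⊗[k] H) = antipode k w := by
    rw [hw, kappaMul, antipodeMul, show p.kappa = antipode k from
      LinearMap.ext (p.kappa_eq_antipode h)]
  have := p.apply_mul_mulAntipode_mul (y := 1)
    (fun a => by rw [mul_one, one_mul, p.kappa_eq_antipode h]) hw
  rw [← this, mul_one, ← ht, hκ, hβ]

end IsIntegralPair

end Comparison

/-! ### Gauge invariance of the indicators -/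

section GaugeInvariance

variable {k H H' : Type*} [Field k] [Ring H] [HopfAlgebra k H] [FiniteDimensional k H]
  [Ring H'] [HopfAlgebra k H'] [FiniteDimensional k H']

/-- The comparison of the two indicators through `t(P⁽ⁿ⁾(Λ))`. The integral `Λ` of `H` is carried
by `e` from an integral of `H'`, since twisting changes neither the product nor the counit; `t'` and
`S'` are the Frobenius form and the antipode of `H'`, transported to `H`. -/
theorem indicator_eq_of_algEquiv {F : (H ⊗[k] H)ˣ} (hF : IsTwist F) (e : H' ≃ₐ[k] H)
    (hcounit : ∀ x, counit (R := k) (e x) = counit (R := k) x)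
    (hcomul : ∀ x, TensorProduct.map e.toLinearMap e.toLinearMap (comul (R := k) x) =
      twistedComul F (e x)) (n : ℤ) :
    indicator k H n = indicator k H' n := by
  obtain ⟨Λ, hΛ, h0⟩ := exists_isLeftIntegral_ne_zero k H
  obtain ⟨t, ht⟩ := hΛ.exists_slice_comul_eq_one h0
  have p : IsIntegralPair Λ t := ⟨hΛ, ht⟩
  have hΛ' : IsLeftIntegral k (e.symm Λ) := fun h => by
    apply e.injective
    rw [map_mul, map_smul, e.apply_symm_apply, hΛ, hcounit]
  obtain ⟨t₀, ht₀⟩ := hΛ'.exists_slice_comul_eq_one (by simpa using h0)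
  have p' : IsIntegralPair (e.symm Λ) t₀ := ⟨hΛ', ht₀⟩
  let t' : H →ₗ[k] k := t₀ ∘ₗ e.symm.toLinearMap
  let S' : H →ₗ[k] H := e.toLinearMap ∘ₗ antipode k ∘ₗ e.symm.toLinearMap
  have hS' (y : H) : S' y = slice (t' ∘ₗ LinearMap.mulLeft k y) (twistedComul F Λ) := by
    have h := hcomul (e.symm Λ)
    rw [e.apply_symm_apply] at h
    change e (antipode k (e.symm y)) = _
    rw [← p'.slice_comul_mulLeft, ← h]
    induction comul (R := k) (e.symm Λ) with
    | zero => simp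
    | add X Y hX hY => simp only [map_add, hX, hY]
    | tmul a b => simp [t']
  have h1 : S' 1 = 1 := by simp [S']
  rw [p.indicator_eq, p'.indicator_eq]
  have ht' (x : H') : t₀ x = t' (e x) := by simp [t']
  cases n with
  | ofNat n =>
    cases n with
    | zero =>
      have h := p.apply_one_mul_counit hF hS' h1
      rw [Int.ofNat_eq_natCast, Nat.cast_zero, sweedlerPow_zero_apply, sweedlerPow_zero_apply, ht',
        ← hcounit, e.apply_symm_apply, Algebra.algebraMap_eq_smul_one,
        Algebra.algebraMap_eq_smul_one, map_smul, map_smul, map_smul, map_one e]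
      exact h.symm
    | succ m =>
      have h : e (itMul (comul (R := k)) m (e.symm Λ)) = itMul (twistedComul F).toLinearMap m Λ := by
        simpa using map_itMul e.toAlgHom (D := (twistedComul F).toLinearMap) hcomul m (e.symm Λ)
      rw [Int.ofNat_eq_natCast, Nat.cast_succ, sweedlerPow_natCast_add_one,
        sweedlerPow_natCast_add_one, ht', h, p.apply_itMul hF hS' h1]
  | negSucc m =>
    have h : e (itMulOp (comul (R := k)) m (e.symm Λ)) = itMulOp (twistedComul F).toLinearMap m Λ := by
      simpa using map_itMulOp e.toAlgHom (D := (twistedComul F).toLinearMap) hcomul m (e.symm Λ)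
    rw [Int.negSucc_eq, sweedlerPow_neg_natCast_add_one, sweedlerPow_neg_natCast_add_one,
      LinearMap.comp_apply, LinearMap.comp_apply, ← p.apply_antipode_itMulOp hF hS' h1, ← h, ht']
    simp [S']

end GaugeInvariance

end HopfGauge

theorem mainTheorem4 {k : Type*} [Field k] {H H' : Type*}
    [Ring H] [HopfAlgebra k H] [FiniteDimensional k H]
    [Ring H'] [HopfAlgebra k H'] [FiniteDimensional k H']
    (hgauge : HopfGauge.GaugeEquivalent k H H') (n : ℤ) :
    HopfGauge.indicator k H n = HopfGauge.indicator k H' n := by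
  obtain ⟨F, hF, ⟨Ψ⟩⟩ := hgauge
  let e : H' ≃ₐ[k] HopfGauge.Twisted F := (Ψ : H' ≃ₐ[k] HopfGauge.Twisted F)
  refine HopfGauge.indicator_eq_of_algEquiv hF (e : H' ≃ₐ[k] H) (fun x => ?_) (fun x => ?_) n
  · exact congr($(Ψ.counit_comp) x)
  · exact congr($(Ψ.map_comp_comul) x)
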